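/- Let $k\ge 2$, let $x_1,\dots,x_k$ be variables of positive even degrees $|x_1|\le\dots\le|x_k|$, and give $\mathbb{Q}[x_1,\dots,x_k]$ the induced grading. Let $u_1,\dots,u_k\in\mathbb{Q}[x_1,\dots,x_k]$ be homogeneous polynomials without constant or linear terms (every monomial $x_1^{a_1}\cdots x_k^{a_k}$ occurring in them has $a_1+\dots+a_k\ge 2$) that form a regular sequence, with degrees $|u_1|\le\dots\le|u_k|$ and $|u_i|\ge 2|x_i|$ for all $i$, and let $$H^*=\mathbb{Q}[x_1,\dots,x_k]/(u_1,\dots,u_k)$$ with the induced grading. A *positively elliptic algebra* is a graded algebra that is a quotient of a polynomial ring over $\mathbb{Q}$ in $l\ge 0$ variables of positive even degrees by an ideal generated by a regular sequence of $l$ homogeneous polynomials; it is *non-trivial* if it is non-zero in some positive degree. Say that $H^*$ *splits* if there are non-trivial positively elliptic algebras $K^*$, $Q^*$ and an exact sequence $0\to K^*\to H^*\to Q^*\to 0$ of graded algebras, meaning: $K^*\to H^*$ is an injective homomorphism of graded algebras that makes $H^*$ a free $K^*$-module, and $H^*\to Q^*$ is a surjective homomorphism of graded algebras whose kernel is the ideal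 of $H^*$ generated by the image of $K^{>0}$. The *formal dimension* $\operatorname{fd}H^*$ is the largest $n$ with $H^n\ne 0$. Assume that $H^*$ does not split, that $|x_{k-1}|+|x_k|\le 8$, and that there is a non-zero $\mathbb{Q}$-linear derivation $\delta$ of $H^*$ of negative degree, that is, $\delta(H^n)\subseteq H^{n+d}$ for all $n$, for some fixed integer $d<0$ (with $H^j=0$ for $j<0$). Then $\operatorname{fd}H^*>20$. -/

import Mathlib

/-- A presentation `ℚ[x₁, …, x_k] / (u₁, …, u_k)` of a (non-zero) positively elliptic algebra:
the variable `x i` has positive even degree `genDeg i`, the polynomial `rel i` is homogeneous of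
degree `relDeg i` for the induced grading, and the relations form a regular sequence. -/
structure EllipticPresentation (k : ℕ) where
  genDeg : Fin k → ℕ
  genDeg_pos : ∀ i, 0 < genDeg i
  genDeg_even : ∀ i, Even (genDeg i)
  rel : Fin k → MvPolynomial (Fin k) ℚ
  relDeg : Fin k → ℕ
  rel_homogeneous : ∀ i, MvPolynomial.IsWeightedHomogeneous genDeg (rel i) (relDeg i)
  regular : RingTheory.Sequence.IsRegular (MvPolynomial (Fin k) ℚ) (List.ofFn rel)

namespace EllipticPresentation

/-- The ideal `(u₁, …, u_k)`. -/
noncomputable def relIdeal {k : ℕ} (P : EllipticPresentation k) : Ideal (MvPolynomial (Fin k) ℚ) :=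
  Ideal.span (Set.range P.rel)

/-- The positively elliptic algebra `H = ℚ[x₁, …, x_k] / (u₁, …, u_k)`. -/
abbrev Alg {k : ℕ} (P : EllipticPresentation k) : Type :=
  MvPolynomial (Fin k) ℚ ⧸ P.relIdeal

/-- The graded piece `H^n`: the image of the homogeneous polynomials of degree `n`. -/
noncomputable def piece {k : ℕ} (P : EllipticPresentation k) (n : ℕ) : Submodule ℚ P.Alg :=
  (MvPolynomial.weightedHomogeneousSubmodule ℚ P.genDeg n).map
    (Ideal.Quotient.mkₐ ℚ P.relIdeal).toLinearMap

/-- The formal dimension (socle degree): the largest `n` with `H^n ≠ 0`. -/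
noncomputable def formalDim {k : ℕ} (P : EllipticPresentation k) : ℕ :=
  sSup {n | P.piece n ≠ ⊥}

/-- `H` is not concentrated in degree zero. -/
def HasPositiveDegree {k : ℕ} (P : EllipticPresentation k) : Prop :=
  ∃ n, 0 < n ∧ P.piece n ≠ ⊥

/-- The presentation is a pure model: the relations have neither constant nor linear terms,
generators and relations are ordered by degree, and `|u i| ≥ 2 |x i|`. -/
structure IsPureModel {k : ℕ} (P : EllipticPresentation k) : Prop where
  two_le_of_mem_support : ∀ i, ∀ a ∈ (P.rel i).support, 2 ≤ a.degree
  genDeg_mono : Monotone P.genDeg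
  relDeg_mono : Monotone P.relDeg
  two_mul_genDeg_le : ∀ i, 2 * P.genDeg i ≤ P.relDeg i

/-- The sequence `0 → K → H → Q → 0` of homomorphisms of connected graded algebras is exact:
`ι` is injective and makes `H` a free `K`-module, and `π` is surjective with kernel the ideal of
`H` generated by the image of `K^{>0}`. -/
structure IsExtension {l k m : ℕ} {K : EllipticPresentation l} {H : EllipticPresentation k}
    {Q : EllipticPresentation m} (ι : K.Alg →ₐ[ℚ] H.Alg) (π : H.Alg →ₐ[ℚ] Q.Alg) : Prop where
  map_piece_left : ∀ n, ∀ x ∈ K.piece n, ι x ∈ H.piece n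
  map_piece_right : ∀ n, ∀ x ∈ H.piece n, π x ∈ Q.piece n
  injective : Function.Injective ι
  free : letI : Algebra K.Alg H.Alg := ι.toRingHom.toAlgebra
    Module.Free K.Alg H.Alg
  surjective : Function.Surjective π
  ker_eq : RingHom.ker π = Ideal.span {y | ∃ n, 0 < n ∧ ∃ x ∈ K.piece n, ι x = y}

/-- `H` splits: it is an extension of two non-trivial positively elliptic algebras. Non-trivial
means different from `0` and from `ℚ` (with `K = ℚ` or `Q = ℚ` every algebra would split). -/
def Splits {k : ℕ} (P : EllipticPresentation k) : Prop :=
  ∃ (l m : ℕ) (K : EllipticPresentation l) (Q : EllipticPresentation m)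
    (ι : K.Alg →ₐ[ℚ] P.Alg) (π : P.Alg →ₐ[ℚ] Q.Alg),
    K.HasPositiveDegree ∧ Q.HasPositiveDegree ∧ IsExtension ι π

/-- The derivation `δ` raises degrees by the integer `d`, where `H^n = 0` for `n < 0`. As `H` lives
in even degrees, the sign `(-1) ^ (|δ| |x|)` in the graded Leibniz rule is always `1`, so graded
derivations are derivations in the ungraded sense. -/
def HasDegree {k : ℕ} (P : EllipticPresentation k) (δ : Derivation ℚ P.Alg P.Alg) (d : ℤ) : Prop :=
  ∀ n : ℕ, ∀ x ∈ P.piece n,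
    (∀ m : ℕ, (m : ℤ) = n + d → δ x ∈ P.piece m) ∧ ((n : ℤ) + d < 0 → δ x = 0)

end EllipticPresentation

/-! Write `I` for the ideal of relations, `g i` and `b i` for the degrees of generators and
relations. Regularity makes the Hilbert series `∏ (1 - t ^ b i) / ∏ (1 - t ^ g i)`, so the top
non-zero degree of `H` is `∑ (b i - g i)`. Assuming `fd H ≤ 20` turns this into a budget from which
each index takes `b i - g i ≥ g i`; the aim is `δ = 0`.

The engine is `HasDegree.apply_eq_zero_of_mul_eq_zero`: if `h * δ xᵢ = 0` for all `i`, then `δ h =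
0`. It holds because a lift `D` of `δ` has no divergence and because syzygies of a regular sequence
have coefficients in `I`. Applied to `κ * xᵢ ^ (n + 1)` it gives
`HasDegree.coeff_eq_zero_of_rank_one`: if `δ κ = 0` and all `κ * δ xᵢ` lie on one line, they vanish.

For degree reasons `δ` is non-zero on at most one generator, and then `κ = 1` suffices, unless all
generators have degree 2 or 4 and `δ` has degree `-2`. In that case `D` kills the generators of
degree 2 and sends those of degree 4 to linear forms `p i` in the former. If all `p i` are
proportional, `κ = 1` works again.

Otherwise let `φ = aeval p`. On polynomials of degree `4 * n` one has `D ^ n = n! φ`. As every `xᵢ`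
is nilpotent in `H`, the polynomials `φ(uⱼ)` have no common non-unit factor. Tracing which relations
can have `φ(uⱼ) ≠ 0`, and what each costs in the budget, shows that two relations of degree 8 have
independent images. This forces at least two relations of degree 4 and two of degree 6, and the
budget of 20 is then spent exactly. A dimension count shows that the products `p i * p j` span a
line in `H` (`IsStep.exists_rank_one`), and `κ = p i` finishes the proof. -/

open MvPolynomial

/-! ### Regular sequences and their syzygies -/

/-- Each `f j` is a nonzerodivisor modulo the ideal generated by its predecessors. -/
def IsRegularFamily {R : Type*} [CommRing R] {r : ℕ} (f : Fin r → R) : Prop :=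
  ∀ j g, f j * g ∈ Ideal.span (f '' {i | i < j}) → g ∈ Ideal.span (f '' {i | i < j})

theorem isRegularFamily_of_isWeaklyRegular {R : Type*} [CommRing R] {r : ℕ} {f : Fin r → R}
    (h : RingTheory.Sequence.IsWeaklyRegular R (List.ofFn f)) : IsRegularFamily f := by
  intro j g hg
  have hj : (j : ℕ) < (List.ofFn f).length := by simp
  have hreg := h.regular_mod_prev j hj
  have hI : (Ideal.ofList ((List.ofFn f).take j) • ⊤ : Submodule R R)
      = Ideal.span (f '' {i | i < j}) := by
    have : (Ideal.ofList ((List.ofFn f).take j) • ⊤ : Submodule R R)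
      = Ideal.ofList ((List.ofFn f).take j) := by simp
    rw [this, Ideal.ofList]
    congr 1
    ext x
    simp only [Set.mem_ofPred_eq, Set.mem_image, List.mem_take_iff_getElem, List.getElem_ofFn]
    constructor
    · rintro ⟨i, hi, rfl⟩
      have hi' : i < r := by simp at hi; omega
      exact ⟨⟨i, hi'⟩, by simp at hi; exact Fin.lt_def.2 hi, rfl⟩
    · rintro ⟨i, hi, rfl⟩
      exact ⟨i, by have := Fin.lt_def.1 hi; simp; omega, rfl⟩
  rw [hI] at hreg
  have hsm := isSMulRegular_quotient_iff_mem_of_smul_mem (N := Ideal.span (f '' {i | i < j}))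
    (r := (List.ofFn f)[(j : ℕ)])
  have := hsm.1 hreg g
  simp only [List.getElem_ofFn, Fin.eta, smul_eq_mul] at this
  exact this hg

theorem IsRegularFamily.castSucc {R : Type*} [CommRing R] {r : ℕ} {f : Fin (r + 1) → R}
    (h : IsRegularFamily f) : IsRegularFamily (fun i : Fin r => f i.castSucc) := by
  intro j g hg
  have key : (fun i : Fin r => f i.castSucc) '' {i | i < j} = f '' {i | i < j.castSucc} := by
    ext x
    constructor
    · rintro ⟨i, hi, rfl⟩
      exact ⟨i.castSucc, hi, rfl⟩
    · rintro ⟨i, hi, rfl⟩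
      have hi' : (i : ℕ) < j := Fin.lt_def.1 hi
      exact ⟨⟨i, by omega⟩, Fin.lt_def.2 hi', rfl⟩
  rw [key] at hg ⊢
  exact h _ _ hg

theorem image_lt_last {R : Type*} {r : ℕ} (f : Fin (r + 1) → R) :
    f '' {i | i < Fin.last r} = Set.range (fun i : Fin r => f i.castSucc) := by
  ext x
  constructor
  · rintro ⟨i, hi, rfl⟩
    exact ⟨⟨i, Fin.lt_def.1 hi⟩, rfl⟩
  · rintro ⟨i, rfl⟩
    exact ⟨i.castSucc, Fin.castSucc_lt_last i, rfl⟩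

theorem range_eq_insert_last {R : Type*} {r : ℕ} (f : Fin (r + 1) → R) :
    Set.range f = insert (f (Fin.last r)) (Set.range (fun i : Fin r => f i.castSucc)) := by
  ext x
  constructor
  · rintro ⟨i, rfl⟩
    refine Fin.lastCases ?_ (fun j => ?_) i
    · exact Or.inl rfl
    · exact Or.inr ⟨j, rfl⟩
  · rintro (rfl | ⟨i, rfl⟩)
    · exact ⟨_, rfl⟩
    · exact ⟨_, rfl⟩

/-- The coefficients of a syzygy of a regular family lie in the ideal it generates. -/
theorem IsRegularFamily.mem_of_sum_eq_zero {R : Type*} [CommRing R] {r : ℕ} {f : Fin r → R}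
    (h : IsRegularFamily f) {g : Fin r → R} (hg : ∑ i, g i * f i = 0) (j : Fin r) :
    g j ∈ Ideal.span (Set.range f) := by
  induction r with
  | zero => exact j.elim0
  | succ r ih =>
    rw [Fin.sum_univ_castSucc] at hg
    have hlast : g (Fin.last r) ∈ Ideal.span (Set.range fun i : Fin r => f i.castSucc) := by
      rw [← image_lt_last]
      apply h
      rw [image_lt_last]
      have : f (Fin.last r) * g (Fin.last r) = ∑ i : Fin r, (-g i.castSucc) * f i.castSucc := by
        simp only [neg_mul, Finset.sum_neg_distrib]
        linear_combination hg
      rw [this]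
      exact Ideal.sum_mem _ fun i _ => Ideal.mul_mem_left _ _ (Ideal.subset_span ⟨i, rfl⟩)
    have hle : Ideal.span (Set.range fun i : Fin r => f i.castSucc) ≤ Ideal.span (Set.range f) := by
      apply Ideal.span_mono
      rintro _ ⟨i, rfl⟩
      exact ⟨_, rfl⟩
    refine Fin.lastCases (hle hlast) (fun i => ?_) j
    obtain ⟨e, he⟩ := (Ideal.mem_span_range_iff_exists_fun).1 hlast
    -- Expanding the last coefficient as `∑ e i * f i` leaves a shorter syzygy, whose coefficients
    -- differ from the `g i` by multiples of the last element.
    have h2 : ∑ i : Fin r, (g i.castSucc + e i * f (Fin.last r)) * f i.castSucc = 0 := by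
      have : ∑ i : Fin r, (g i.castSucc + e i * f (Fin.last r)) * f i.castSucc
          = ∑ i : Fin r, g i.castSucc * f i.castSucc
            + (∑ i : Fin r, e i * f i.castSucc) * f (Fin.last r) := by
        rw [Finset.sum_mul, ← Finset.sum_add_distrib]
        exact Finset.sum_congr rfl fun i _ => by ring
      rw [this, he, hg]
    have h3 := hle (ih h.castSucc h2 i)
    have h4 : e i * f (Fin.last r) ∈ Ideal.span (Set.range f) :=
      Ideal.mul_mem_left _ _ (Ideal.subset_span ⟨_, rfl⟩)
    simpa using Ideal.sub_mem _ h3 h4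

/-! ### Homogeneous components in ideals with homogeneous generators -/

section Graded

variable {σ : Type*} {w : σ → ℕ}

theorem coe_decompose_weighted (f : MvPolynomial σ ℚ) (n : ℕ) :
    let _ := weightedGradedAlgebra ℚ w
    (DirectSum.decompose (weightedHomogeneousSubmodule ℚ w) f n : MvPolynomial σ ℚ)
      = weightedHomogeneousComponent w n f := by
  intro _
  exact weightedDecomposition.decompose'_apply ℚ w f n

theorem weightedHomogeneousComponent_mul_of_le {f u : MvPolynomial σ ℚ} {n b : ℕ}
    (hu : IsWeightedHomogeneous w u b) (hb : b ≤ n) :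
    weightedHomogeneousComponent w n (f * u) = weightedHomogeneousComponent w (n - b) f * u := by
  let _ := weightedGradedAlgebra ℚ w
  have := DirectSum.coe_decompose_mul_of_right_mem_of_le (weightedHomogeneousSubmodule ℚ w)
    (a := f) (n := n) ((mem_weightedHomogeneousSubmodule ℚ w b u).2 hu) hb
  simpa only [coe_decompose_weighted] using this

theorem weightedHomogeneousComponent_mul_of_lt {f u : MvPolynomial σ ℚ} {n b : ℕ}
    (hu : IsWeightedHomogeneous w u b) (hb : n < b) :
    weightedHomogeneousComponent w n (f * u) = 0 := by
  let _ := weightedGradedAlgebra ℚ w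
  have := DirectSum.coe_decompose_mul_of_right_mem_of_not_le (weightedHomogeneousSubmodule ℚ w)
    (a := f) (n := n) ((mem_weightedHomogeneousSubmodule ℚ w b u).2 hu) (by omega)
  simpa only [coe_decompose_weighted] using this

/-- A homogeneous element of an ideal generated by homogeneous elements is a combination with
homogeneous coefficients of the expected degrees. -/
theorem exists_homogeneous_coeffs {r : ℕ} {u : Fin r → MvPolynomial σ ℚ} {b : Fin r → ℕ}
    (hu : ∀ i, IsWeightedHomogeneous w (u i) (b i)) {f : MvPolynomial σ ℚ} {n : ℕ}
    (hf : IsWeightedHomogeneous w f n) (hmem : f ∈ Ideal.span (Set.range u)) :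
    ∃ c : Fin r → MvPolynomial σ ℚ, f = ∑ i, c i * u i ∧
      ∀ i, IsWeightedHomogeneous w (c i) (n - b i) ∧ (n < b i → c i = 0) := by
  obtain ⟨e, he⟩ := (Ideal.mem_span_range_iff_exists_fun).1 hmem
  -- The value `0` is forced for `n < b i`, where the truncated `n - b i` would wrongly select the
  -- component of degree 0.
  refine ⟨fun i => if b i ≤ n then weightedHomogeneousComponent w (n - b i) (e i) else 0, ?_,
    fun i => ⟨?_, fun h => if_neg (by omega)⟩⟩
  · rw [← hf.weightedHomogeneousComponent_same, ← he, map_sum]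
    refine Finset.sum_congr rfl fun i _ => ?_
    dsimp only
    split_ifs with h
    · exact weightedHomogeneousComponent_mul_of_le (hu i) h
    · rw [weightedHomogeneousComponent_mul_of_lt (hu i) (by omega), zero_mul]
  · dsimp only
    split_ifs
    · exact weightedHomogeneousComponent_isWeightedHomogeneous _ _
    · exact isWeightedHomogeneous_zero _ _ _

theorem weightedHomogeneousComponent_mem_span {r : ℕ} {u : Fin r → MvPolynomial σ ℚ}
    {b : Fin r → ℕ} (hu : ∀ i, IsWeightedHomogeneous w (u i) (b i)) {f : MvPolynomial σ ℚ}
    (hmem : f ∈ Ideal.span (Set.range u)) (n : ℕ) :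
    weightedHomogeneousComponent w n f ∈ Ideal.span (Set.range u) := by
  obtain ⟨e, he⟩ := (Ideal.mem_span_range_iff_exists_fun).1 hmem
  rw [← he, map_sum]
  refine Ideal.sum_mem _ fun i _ => ?_
  by_cases h : b i ≤ n
  · rw [weightedHomogeneousComponent_mul_of_le (hu i) h]
    exact Ideal.mul_mem_left _ _ (Ideal.subset_span ⟨i, rfl⟩)
  · rw [weightedHomogeneousComponent_mul_of_lt (hu i) (by omega)]
    exact Ideal.zero_mem _

end Graded

/-! ### Hilbert series modulo a homogeneous regular sequence -/

section HilbertFunction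

variable {σ : Type*}

/-- The image of the homogeneous polynomials of degree `n` in `ℚ[σ] ⧸ J`. -/
noncomputable def gradedQuot (w : σ → ℕ) (J : Ideal (MvPolynomial σ ℚ)) (n : ℕ) :
    Submodule ℚ (MvPolynomial σ ℚ ⧸ J) :=
  (weightedHomogeneousSubmodule ℚ w n).map (Ideal.Quotient.mkₐ ℚ J).toLinearMap

/-- The Hilbert function of `ℚ[σ] ⧸ J`. -/
noncomputable def hilb (w : σ → ℕ) (J : Ideal (MvPolynomial σ ℚ)) (n : ℕ) : ℕ :=
  Module.finrank ℚ (gradedQuot w J n)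

theorem mem_gradedQuot {w : σ → ℕ} {J : Ideal (MvPolynomial σ ℚ)} {n : ℕ}
    {z : MvPolynomial σ ℚ ⧸ J} :
    z ∈ gradedQuot w J n ↔ ∃ g, IsWeightedHomogeneous w g n ∧ Ideal.Quotient.mk J g = z :=
  Iff.rfl

theorem finiteDimensional_gradedQuot [Finite σ] {w : σ → ℕ} (hw : ∀ i, w i ≠ 0)
    (J : Ideal (MvPolynomial σ ℚ)) (n : ℕ) : FiniteDimensional ℚ (gradedQuot w J n) :=
  Module.Finite.iff_fg.2 ((weightedHomogeneousSubmodule_fg ℚ w hw n).map _)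

theorem hilb_eq_zero_iff [Finite σ] {w : σ → ℕ} (hw : ∀ i, w i ≠ 0) (J : Ideal (MvPolynomial σ ℚ)) (n : ℕ) :
    hilb w J n = 0 ↔ gradedQuot w J n = ⊥ := by
  have := finiteDimensional_gradedQuot hw J n
  exact Submodule.finrank_eq_zero

theorem hilb_eq_add_finrank [Finite σ] {w : σ → ℕ} (hw : ∀ i, w i ≠ 0) {J J' : Ideal (MvPolynomial σ ℚ)}
    (hle : J ≤ J') (n : ℕ) :
    hilb w J n = hilb w J' n + Module.finrank ℚ
      (gradedQuot w J n ⊓ LinearMap.ker (Ideal.Quotient.factorₐ ℚ hle).toLinearMap :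
        Submodule ℚ (MvPolynomial σ ℚ ⧸ J)) := by
  have := finiteDimensional_gradedQuot hw J n
  set ψ := (Ideal.Quotient.factorₐ ℚ hle).toLinearMap with hψ
  have h1 := LinearMap.finrank_range_add_finrank_ker (ψ.domRestrict (gradedQuot w J n))
  have h2 : LinearMap.range (ψ.domRestrict (gradedQuot w J n)) = gradedQuot w J' n := by
    rw [LinearMap.range_domRestrict, gradedQuot, ← Submodule.map_comp]
    rfl
  have h3 : (LinearMap.ker (ψ.domRestrict (gradedQuot w J n))).map (gradedQuot w J n).subtype
      = gradedQuot w J n ⊓ LinearMap.ker ψ := by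
    rw [LinearMap.ker_domRestrict, Submodule.map_comap_eq, Submodule.range_subtype]
  rw [h2, ← Submodule.finrank_map_subtype_eq, h3] at h1
  exact h1.symm

section Step

variable {w : σ → ℕ} {J J' : Ideal (MvPolynomial σ ℚ)} {f : MvPolynomial σ ℚ} {b : ℕ}

theorem exists_mul_add_mem
    (hJ : ∀ g ∈ J, ∀ n, weightedHomogeneousComponent w n g ∈ J)
    (hf : IsWeightedHomogeneous w f b) (hJ' : J' = Ideal.span {f} ⊔ J)
    (n : ℕ) {g : MvPolynomial σ ℚ}
    (hg : IsWeightedHomogeneous w g n) (hgJ : g ∈ J') :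
    ∃ c, IsWeightedHomogeneous w c (n - b) ∧ (n < b → c = 0) ∧ g - f * c ∈ J := by
  rw [hJ', Ideal.mem_span_singleton_sup] at hgJ
  obtain ⟨a, j, hj, rfl⟩ := hgJ
  have hself := hg.weightedHomogeneousComponent_same
  rw [map_add] at hself
  by_cases hb : b ≤ n
  · refine ⟨weightedHomogeneousComponent w (n - b) a,
      weightedHomogeneousComponent_isWeightedHomogeneous _ _, by omega, ?_⟩
    rw [weightedHomogeneousComponent_mul_of_le hf hb] at hself
    have : a * f + j - f * weightedHomogeneousComponent w (n - b) a
        = weightedHomogeneousComponent w n j := by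
      linear_combination -hself
    rw [this]
    exact hJ _ hj n
  · refine ⟨0, isWeightedHomogeneous_zero _ _ _, by simp, ?_⟩
    rw [weightedHomogeneousComponent_mul_of_lt hf (by omega), zero_add] at hself
    rw [← hself]
    simpa using hJ _ hj n

theorem hilb_sup_of_lt [Finite σ]
    (hJ : ∀ g ∈ J, ∀ n, weightedHomogeneousComponent w n g ∈ J)
    (hf : IsWeightedHomogeneous w f b) (hJ' : J' = Ideal.span {f} ⊔ J)
    (hw : ∀ i, w i ≠ 0) {n : ℕ} (hn : n < b) :
    hilb w J n = hilb w J' n := by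
  have hle : J ≤ J' := hJ' ▸ le_sup_right
  rw [hilb_eq_add_finrank hw hle]
  suffices h : gradedQuot w J n ⊓ LinearMap.ker (Ideal.Quotient.factorₐ ℚ hle).toLinearMap = ⊥ by
    rw [h, finrank_bot, add_zero]
  rw [eq_bot_iff]
  rintro z ⟨hz, hz'⟩
  obtain ⟨g, hg, rfl⟩ := mem_gradedQuot.1 hz
  have hgJ : g ∈ J' := by
    have : Ideal.Quotient.mk J' g = 0 := hz'
    exact Ideal.Quotient.eq_zero_iff_mem.1 this
  obtain ⟨c, -, hc, hmem⟩ := exists_mul_add_mem hJ hf hJ' n hg hgJ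
  rw [hc hn, mul_zero, sub_zero] at hmem
  exact Ideal.Quotient.eq_zero_iff_mem.2 hmem

/-- Degree `n` of the exact sequence `0 → R/J → R/J → R/J' → 0`, whose first map is multiplication
by `f` and shifts degrees by `b`. -/
theorem hilb_sup_of_le [Finite σ]
    (hJ : ∀ g ∈ J, ∀ n, weightedHomogeneousComponent w n g ∈ J)
    (hreg : ∀ g, f * g ∈ J → g ∈ J)
    (hf : IsWeightedHomogeneous w f b) (hJ' : J' = Ideal.span {f} ⊔ J)
    (hw : ∀ i, w i ≠ 0) {n : ℕ} (hn : b ≤ n) :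
    hilb w J n = hilb w J' n + hilb w J (n - b) := by
  have hle : J ≤ J' := hJ' ▸ le_sup_right
  rw [hilb_eq_add_finrank hw hle]
  congr 1
  let μ : (MvPolynomial σ ℚ ⧸ J) →ₗ[ℚ] (MvPolynomial σ ℚ ⧸ J) :=
    LinearMap.mulLeft ℚ (Ideal.Quotient.mk J f)
  have hμ : Function.Injective μ := by
    rw [← LinearMap.ker_eq_bot, eq_bot_iff]
    intro z hz
    obtain ⟨g, rfl⟩ := Ideal.Quotient.mk_surjective z
    have h0 : Ideal.Quotient.mk J (f * g) = 0 := by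
      rw [map_mul]; exact hz
    exact Ideal.Quotient.eq_zero_iff_mem.2 (hreg g (Ideal.Quotient.eq_zero_iff_mem.1 h0))
  have key : gradedQuot w J n ⊓ LinearMap.ker (Ideal.Quotient.factorₐ ℚ hle).toLinearMap
      = (gradedQuot w J (n - b)).map μ := by
    apply le_antisymm
    · rintro z ⟨hz, hz'⟩
      obtain ⟨g, hg, rfl⟩ := mem_gradedQuot.1 hz
      have hgJ : g ∈ J' := by
        have : Ideal.Quotient.mk J' g = 0 := hz'
        exact Ideal.Quotient.eq_zero_iff_mem.1 this
      obtain ⟨c, hc, -, hmem⟩ := exists_mul_add_mem hJ hf hJ' n hg hgJ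
      refine ⟨Ideal.Quotient.mk J c, mem_gradedQuot.2 ⟨c, hc, rfl⟩, ?_⟩
      have : Ideal.Quotient.mk J g = Ideal.Quotient.mk J (f * c) := Ideal.Quotient.eq.2 hmem
      rw [this, map_mul]
      rfl
    · rintro _ ⟨z, hz, rfl⟩
      obtain ⟨g, hg, rfl⟩ := mem_gradedQuot.1 hz
      refine ⟨mem_gradedQuot.2 ⟨f * g, ?_, map_mul _ _ _⟩, ?_⟩
      · have := hf.mul hg
        rwa [Nat.add_sub_cancel' hn] at this
      · have : f * g ∈ J' := by
          rw [hJ']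
          exact Ideal.mul_mem_right _ _ (Ideal.mem_sup_left (Ideal.mem_span_singleton_self f))
        have h2 : Ideal.Quotient.mk J' (f * g) = 0 := Ideal.Quotient.eq_zero_iff_mem.2 this
        exact h2
  rw [key]
  exact (Submodule.equivMapOfInjective μ hμ _).finrank_eq.symm

end Step

/-- The Hilbert series of `ℚ[σ] ⧸ J`. -/
noncomputable def hilbSeries (w : σ → ℕ) (J : Ideal (MvPolynomial σ ℚ)) : PowerSeries ℤ :=
  PowerSeries.mk fun n => (hilb w J n : ℤ)

/-- The series of the polynomial ring itself stays unevaluated: it is eliminated later by applying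
this same formula to the variables, whose quotient is `ℚ`. -/
theorem hilbSeries_span_range [Finite σ] {w : σ → ℕ} (hw : ∀ i, w i ≠ 0) {r : ℕ}
    {u : Fin r → MvPolynomial σ ℚ} {b : Fin r → ℕ} (hu : ∀ i, IsWeightedHomogeneous w (u i) (b i))
    (hreg : IsRegularFamily u) :
    hilbSeries w (Ideal.span (Set.range u))
      = hilbSeries w ⊥ * ∏ i, (1 - (PowerSeries.X : PowerSeries ℤ) ^ b i) := by
  induction r with
  | zero => simp
  | succ r ih =>
    rw [Fin.prod_univ_castSucc, ← mul_assoc, ← ih (fun i => hu i.castSucc) hreg.castSucc]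
    set J := Ideal.span (Set.range fun i : Fin r => u i.castSucc) with hJdef
    have hJ' : Ideal.span (Set.range u) = Ideal.span {u (Fin.last r)} ⊔ J := by
      rw [range_eq_insert_last, Ideal.span_insert]
    have hJ : ∀ g ∈ J, ∀ n, weightedHomogeneousComponent w n g ∈ J := fun g hg n =>
      weightedHomogeneousComponent_mem_span (fun i : Fin r => hu i.castSucc) hg n
    have hr : ∀ g, u (Fin.last r) * g ∈ J → g ∈ J := by
      intro g hg
      have := hreg (Fin.last r) g
      rw [image_lt_last] at this
      exact this hg
    ext n
    rw [mul_sub, mul_one, map_sub, PowerSeries.coeff_mul_X_pow']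
    simp only [hilbSeries, PowerSeries.coeff_mk]
    split_ifs with hn
    · rw [hilb_sup_of_le hJ hr (hu (Fin.last r)) hJ' hw hn]
      push_cast
      ring
    · rw [hilb_sup_of_lt hJ (hu (Fin.last r)) hJ' hw (by omega)]
      ring

end HilbertFunction

theorem isRegularFamily_X (k : ℕ) :
    IsRegularFamily (X : Fin k → MvPolynomial (Fin k) ℚ) := by
  intro j g hg
  rw [mem_ideal_span_X_image] at hg ⊢
  intro m hm
  obtain ⟨i, hi, hne⟩ := hg (m + Finsupp.single j 1) (by
    rw [mem_support_iff, add_comm, coeff_X_mul]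
    exact mem_support_iff.1 hm)
  refine ⟨i, hi, ?_⟩
  have hij : j ≠ i := (ne_of_lt hi).symm
  simpa [Finsupp.single_apply, hij] using hne

theorem hilbSeries_span_X {k : ℕ} {w : Fin k → ℕ} (hw : ∀ i, w i ≠ 0) :
    hilbSeries w (Ideal.span (Set.range (X : Fin k → MvPolynomial (Fin k) ℚ))) = 1 := by
  set J := Ideal.span (Set.range (X : Fin k → MvPolynomial (Fin k) ℚ)) with hJ
  have hmem : ∀ f : MvPolynomial (Fin k) ℚ, f ∈ J ↔ constantCoeff f = 0 := by
    intro f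
    rw [hJ, ← Set.image_univ, mem_ideal_span_X_image]
    constructor
    · intro h
      by_contra h0
      obtain ⟨i, -, hi⟩ := h 0 (mem_support_iff.2 h0)
      exact hi rfl
    · intro h m hm
      by_contra! hall
      have : m = 0 := Finsupp.ext fun i => hall i trivial
      rw [this] at hm
      exact mem_support_iff.1 hm h
  ext n
  simp only [hilbSeries, PowerSeries.coeff_mk, PowerSeries.coeff_one]
  split_ifs with hn
  · subst hn
    have : gradedQuot w J 0 = Submodule.span ℚ {(1 : MvPolynomial (Fin k) ℚ ⧸ J)} := by
      apply le_antisymm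
      · intro z hz
        obtain ⟨g, -, rfl⟩ := mem_gradedQuot.1 hz
        rw [Submodule.mem_span_singleton]
        refine ⟨constantCoeff g, ?_⟩
        have : Ideal.Quotient.mk J g = Ideal.Quotient.mk J (C (constantCoeff g)) :=
          Ideal.Quotient.eq.2 ((hmem _).2 (by simp))
        rw [this]
        have h := map_smul (Ideal.Quotient.mkₐ ℚ J) (constantCoeff g) 1
        rw [map_one, smul_eq_C_mul, mul_one] at h
        exact h.symm
      · rw [Submodule.span_singleton_le_iff_mem]
        exact mem_gradedQuot.2 ⟨1, isWeightedHomogeneous_one _ _, map_one _⟩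
    rw [hilb, this, finrank_span_singleton]
    · rfl
    · intro h
      have : (1 : MvPolynomial (Fin k) ℚ) ∈ J := Ideal.Quotient.eq_zero_iff_mem.1 h
      rw [hmem] at this
      simp at this
  · rw [Nat.cast_eq_zero, hilb_eq_zero_iff hw, eq_bot_iff]
    intro z hz
    obtain ⟨g, hg, rfl⟩ := mem_gradedQuot.1 hz
    refine Ideal.Quotient.eq_zero_iff_mem.2 ((hmem g).2 ?_)
    exact hg.coeff_eq_zero 0 (by simpa using Ne.symm hn)

/-! ### The formal dimension in terms of the degrees -/

theorem natDegree_geom_sum_eq (n : ℕ) :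
    (∑ i ∈ Finset.range n, (Polynomial.X : Polynomial ℕ) ^ i).natDegree = n - 1 := by
  rcases n with _ | n
  · simp
  · rw [Finset.sum_range_succ]
    rcases n with _ | n
    · simp
    · rw [Polynomial.natDegree_add_eq_right_of_natDegree_lt]
      · simp
      · rw [Polynomial.natDegree_X_pow]
        refine lt_of_le_of_lt (Polynomial.natDegree_sum_le_of_forall_le _ _ (n := n) ?_)
          (Nat.lt_succ_self _)
        intro i hi
        rw [Polynomial.natDegree_X_pow]
        exact Nat.lt_succ_iff.1 (Finset.mem_range.1 hi)

/-- Coefficients in `ℕ` cannot cancel, so a vanishing coefficient of the product kills each summand,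
among them `h n` times the leading coefficient 1. -/
theorem eq_zero_of_mk_mul_eq {h : ℕ → ℕ} {p q : Polynomial ℕ} (hp : p.Monic)
    (heq : PowerSeries.mk h * (p : PowerSeries ℕ) = q) {n : ℕ}
    (hn : q.natDegree < n + p.natDegree) : h n = 0 := by
  have h1 := congrArg (PowerSeries.coeff (n + p.natDegree)) heq
  rw [PowerSeries.coeff_mul, Polynomial.coeff_coe, Polynomial.coeff_eq_zero_of_natDegree_lt hn,
    Finset.sum_eq_zero_iff] at h1
  have h2 := h1 (n, p.natDegree) (Finset.HasAntidiagonal.mem_antidiagonal.2 rfl)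
  simpa [Polynomial.coeff_coe, hp.coeff_natDegree] using h2

/-- The top coefficient of `q` is 1, and only `h n` times the leading coefficient of `p` can
contribute to it. -/
theorem ne_zero_of_mk_mul_eq {h : ℕ → ℕ} {p q : Polynomial ℕ} (hp : p.Monic) (hq : q.Monic)
    (heq : PowerSeries.mk h * (p : PowerSeries ℕ) = q) {n : ℕ}
    (hn : q.natDegree = n + p.natDegree) : h n ≠ 0 := by
  intro h0
  have h1 := congrArg (PowerSeries.coeff q.natDegree) heq
  rw [PowerSeries.coeff_mul, Polynomial.coeff_coe, hq.coeff_natDegree] at h1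
  have h2 : ∑ x ∈ Finset.HasAntidiagonal.antidiagonal q.natDegree,
      (PowerSeries.coeff x.1) (PowerSeries.mk h) * (PowerSeries.coeff x.2) (p : PowerSeries ℕ)
      = 0 := by
    refine Finset.sum_eq_zero fun x hx => ?_
    rw [Finset.HasAntidiagonal.mem_antidiagonal] at hx
    rw [PowerSeries.coeff_mk, Polynomial.coeff_coe]
    rcases lt_trichotomy x.1 n with hlt | heq' | hgt
    · rw [Polynomial.coeff_eq_zero_of_natDegree_lt (by omega), mul_zero]
    · rw [heq', h0, zero_mul]
    · rw [eq_zero_of_mk_mul_eq hp heq (by omega), zero_mul]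
  omega

namespace EllipticPresentation

variable {k : ℕ} (P : EllipticPresentation k)

theorem genDeg_ne_zero (i : Fin k) : P.genDeg i ≠ 0 := (P.genDeg_pos i).ne'

theorem isRegularFamily : IsRegularFamily P.rel :=
  isRegularFamily_of_isWeaklyRegular P.regular.toIsWeaklyRegular

theorem relIdeal_ne_top : P.relIdeal ≠ ⊤ := by
  have h := P.regular.top_ne_smul
  intro htop
  apply h
  have h2 : Ideal.ofList (List.ofFn P.rel) = P.relIdeal := by
    rw [Ideal.ofList, relIdeal]
    congr 1
    ext x
    simp [List.mem_ofFn]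
  rw [h2, htop]
  simp

theorem rel_ne_zero (j : Fin k) : P.rel j ≠ 0 := by
  classical
  intro h0
  apply P.relIdeal_ne_top
  rw [Ideal.eq_top_iff_one]
  -- If `P.rel j = 0`, the `j`-th unit vector is a syzygy, so 1 would lie in the ideal.
  have h : ∑ i, (if i = j then 1 else 0) * P.rel i = 0 := by simp [h0]
  simpa [relIdeal] using P.isRegularFamily.mem_of_sum_eq_zero h j

theorem weight_even (m : Fin k →₀ ℕ) : Even (Finsupp.weight P.genDeg m) := by
  rw [Finsupp.weight_apply, Finsupp.sum]
  exact Finset.even_sum _ fun i _ => (P.genDeg_even i).mul_left _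

theorem eq_zero_of_odd {f : MvPolynomial (Fin k) ℚ} {n : ℕ}
    (hf : IsWeightedHomogeneous P.genDeg f n) (hn : Odd n) : f = 0 := by
  by_contra hne
  obtain ⟨m, hm⟩ := MvPolynomial.ne_zero_iff.1 hne
  have := P.weight_even m
  rw [hf hm] at this
  exact (Nat.not_even_iff_odd.2 hn) this

theorem relDeg_even (j : Fin k) : Even (P.relDeg j) := by
  by_contra h
  exact P.rel_ne_zero j (P.eq_zero_of_odd (P.rel_homogeneous j) (Nat.not_even_iff_odd.1 h))

theorem relDeg_pos (j : Fin k) : 0 < P.relDeg j := by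
  rw [Nat.pos_iff_ne_zero]
  intro h0
  have hhom := P.rel_homogeneous j
  rw [h0] at hhom
  have hC : P.rel j = C (coeff 0 (P.rel j)) := by
    have h1 := weightedHomogeneousComponent_zero (w := P.genDeg) (P.rel j) P.genDeg_ne_zero
    rw [hhom.weightedHomogeneousComponent_same] at h1
    exact h1
  apply P.relIdeal_ne_top
  have hne : coeff 0 (P.rel j) ≠ 0 := by
    intro hz
    rw [hz, C_0] at hC
    exact P.rel_ne_zero j hC
  refine Ideal.eq_top_of_isUnit_mem _ (Ideal.subset_span ⟨j, rfl⟩) ?_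
  rw [hC]
  exact (isUnit_iff_ne_zero.2 hne).map C

/-- The factors `(1 - X) ^ k` are cancelled and the identity is moved from `ℤ` to `ℕ`, so that
positivity can be used to read off the top degree. -/
theorem hilbSeries_mul_prod :
    PowerSeries.mk (hilb P.genDeg P.relIdeal)
        * ((∏ i, ∑ j ∈ Finset.range (P.genDeg i), Polynomial.X ^ j : Polynomial ℕ) : PowerSeries ℕ)
      = ((∏ i, ∑ j ∈ Finset.range (P.relDeg i), Polynomial.X ^ j : Polynomial ℕ) :
          PowerSeries ℕ) := by
  have h1 := hilbSeries_span_range P.genDeg_ne_zero P.rel_homogeneous P.isRegularFamily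
  have h2 := hilbSeries_span_range P.genDeg_ne_zero
    (fun i => isWeightedHomogeneous_X ℚ P.genDeg i) (isRegularFamily_X k)
  rw [hilbSeries_span_X P.genDeg_ne_zero] at h2
  have h3 : hilbSeries P.genDeg P.relIdeal * ∏ i, (1 - (PowerSeries.X : PowerSeries ℤ) ^ P.genDeg i)
      = ∏ i, (1 - (PowerSeries.X : PowerSeries ℤ) ^ P.relDeg i) := by
    rw [relIdeal, h1]
    linear_combination (-∏ i, (1 - (PowerSeries.X : PowerSeries ℤ) ^ P.relDeg i)) * h2
  simp only [← mul_neg_geom_sum, Finset.prod_mul_distrib, Finset.prod_const] at h3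
  have hne : (1 - (PowerSeries.X : PowerSeries ℤ)) ^ (Finset.univ : Finset (Fin k)).card ≠ 0 := by
    apply pow_ne_zero
    intro h
    have := congrArg PowerSeries.constantCoeff h
    simp at this
  rw [mul_left_comm] at h3
  have h4 := mul_left_cancel₀ hne h3
  have hinj : Function.Injective (PowerSeries.map (Nat.castRingHom ℤ)) := by
    intro a b hab
    ext n
    have := congrArg (PowerSeries.coeff n) hab
    simpa using this
  apply hinj
  rw [map_mul]
  have hs : PowerSeries.map (Nat.castRingHom ℤ) (PowerSeries.mk (hilb P.genDeg P.relIdeal))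
      = hilbSeries P.genDeg P.relIdeal := by
    ext n; simp [hilbSeries]
  have hp : ∀ a : Fin k → ℕ, PowerSeries.map (Nat.castRingHom ℤ)
      ((∏ i, ∑ j ∈ Finset.range (a i), Polynomial.X ^ j : Polynomial ℕ) : PowerSeries ℕ)
      = ∏ i, ∑ j ∈ Finset.range (a i), (PowerSeries.X : PowerSeries ℤ) ^ j := by
    intro a
    have : ((∏ i, ∑ j ∈ Finset.range (a i), Polynomial.X ^ j : Polynomial ℕ) : PowerSeries ℕ)
        = ∏ i, ∑ j ∈ Finset.range (a i), (PowerSeries.X : PowerSeries ℕ) ^ j := by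
      rw [← Polynomial.coeToPowerSeries.ringHom_apply, map_prod]
      refine Finset.prod_congr rfl fun i _ => ?_
      rw [map_sum]
      refine Finset.sum_congr rfl fun j _ => ?_
      rw [map_pow, Polynomial.coeToPowerSeries.ringHom_apply, Polynomial.coe_X]
    rw [this, map_prod]
    refine Finset.prod_congr rfl fun i _ => ?_
    rw [map_sum]
    refine Finset.sum_congr rfl fun j _ => ?_
    rw [map_pow, PowerSeries.map_X]
  rw [hs, hp, hp, h4]

theorem monic_prod_geom_sum {a : Fin k → ℕ} (ha : ∀ i, 0 < a i) :
    (∏ i, ∑ j ∈ Finset.range (a i), Polynomial.X ^ j : Polynomial ℕ).Monic :=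
  Polynomial.monic_prod_of_monic _ _ fun i _ => Polynomial.monic_geom_sum_X (ha i).ne'

theorem natDegree_prod_geom_sum {a : Fin k → ℕ} (ha : ∀ i, 0 < a i) :
    (∏ i, ∑ j ∈ Finset.range (a i), Polynomial.X ^ j : Polynomial ℕ).natDegree + k = ∑ i, a i := by
  rw [Polynomial.natDegree_prod_of_monic _ _
    fun i _ => Polynomial.monic_geom_sum_X (ha i).ne']
  simp only [natDegree_geom_sum_eq]
  have h : ∑ i : Fin k, a i = ∑ i : Fin k, ((a i - 1) + 1) :=
    Finset.sum_congr rfl fun i _ => (Nat.sub_add_cancel (ha i)).symm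
  rw [h, Finset.sum_add_distrib]
  simp

theorem piece_eq_bot_of_lt {n : ℕ} (hn : ∑ i, P.relDeg i < n + ∑ i, P.genDeg i) :
    P.piece n = ⊥ := by
  have ha := natDegree_prod_geom_sum P.genDeg_pos
  have hb := natDegree_prod_geom_sum P.relDeg_pos
  exact (hilb_eq_zero_iff P.genDeg_ne_zero _ _).1
    (eq_zero_of_mk_mul_eq (monic_prod_geom_sum P.genDeg_pos) P.hilbSeries_mul_prod
      (n := n) (by omega))

theorem piece_ne_bot {n : ℕ} (hn : ∑ i, P.relDeg i = n + ∑ i, P.genDeg i) :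
    P.piece n ≠ ⊥ := by
  have ha := natDegree_prod_geom_sum P.genDeg_pos
  have hb := natDegree_prod_geom_sum P.relDeg_pos
  intro h
  exact ne_zero_of_mk_mul_eq (monic_prod_geom_sum P.genDeg_pos) (monic_prod_geom_sum P.relDeg_pos)
    P.hilbSeries_mul_prod (n := n) (by omega) ((hilb_eq_zero_iff P.genDeg_ne_zero _ _).2 h)

theorem sum_relDeg_le (n : ℕ) (hn : P.formalDim ≤ n) (hle : ∑ i, P.genDeg i ≤ ∑ i, P.relDeg i) :
    ∑ i, P.relDeg i ≤ n + ∑ i, P.genDeg i := by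
  have hmem : ∑ i, P.relDeg i - ∑ i, P.genDeg i ∈ {n | P.piece n ≠ ⊥} :=
    P.piece_ne_bot (by omega)
  have hbdd : BddAbove {n | P.piece n ≠ ⊥} := by
    refine ⟨∑ i, P.relDeg i, fun n hn => ?_⟩
    by_contra hlt
    exact hn (P.piece_eq_bot_of_lt (by omega))
  -- Boundedness is needed for `formalDim` to be a maximum: `sSup` of an unbounded set in `ℕ` is 0.
  have := le_csSup hbdd hmem
  have : ∑ i, P.relDeg i - ∑ i, P.genDeg i ≤ P.formalDim := this
  omega

theorem X_pow_mem_relIdeal (i : Fin k) : ∃ N, (X i : MvPolynomial (Fin k) ℚ) ^ N ∈ P.relIdeal := by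
  refine ⟨∑ j, P.relDeg j + 1, ?_⟩
  set N := ∑ j, P.relDeg j + 1
  have hdeg := (isWeightedHomogeneous_X ℚ P.genDeg i).pow N
  have hbot := P.piece_eq_bot_of_lt (n := N • P.genDeg i) (by
    have := Nat.le_mul_of_pos_right N (P.genDeg_pos i)
    rw [smul_eq_mul]
    omega)
  have hmem : Ideal.Quotient.mk P.relIdeal (X i ^ N) ∈ P.piece (N • P.genDeg i) :=
    ⟨X i ^ N, hdeg, rfl⟩
  rw [hbot] at hmem
  exact Ideal.Quotient.eq_zero_iff_mem.1 hmem

end EllipticPresentation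

/-! ### Polynomial derivations of negative degree -/

section HomogeneousDerivation

variable {σ : Type*} {w : σ → ℕ}

theorem pderiv_eq_zero_of_degree_lt {f : MvPolynomial σ ℚ} {n : ℕ}
    (hf : IsWeightedHomogeneous w f n) {i : σ} (hn : n < w i) : pderiv i f = 0 := by
  ext m
  rw [coeff_pderiv, coeff_zero, hf.coeff_eq_zero, zero_mul]
  rw [map_add, Finsupp.weight_single]
  simp
  omega

/-- The values `p i` define a derivation of degree `d`. -/
def HasHomogeneousValues (w : σ → ℕ) (d : ℤ) (p : σ → MvPolynomial σ ℚ) : Prop :=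
  ∀ i, (∀ m : ℕ, (m : ℤ) = w i + d → IsWeightedHomogeneous w (p i) m) ∧
    ((w i : ℤ) + d < 0 → p i = 0)

variable {d : ℤ} {p : σ → MvPolynomial σ ℚ}

/-- Since `p i` has smaller degree than `xᵢ`, it cannot involve `xᵢ`. Hence the derivation has
divergence zero. -/
theorem HasHomogeneousValues.pderiv_eq_zero (hp : HasHomogeneousValues w d p) (hd : d < 0)
    (i : σ) : pderiv i (p i) = 0 := by
  by_cases h : (w i : ℤ) + d < 0
  · rw [(hp i).2 h, map_zero]
  · obtain ⟨m, hm⟩ := Int.eq_ofNat_of_zero_le (not_lt.1 h)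
    exact pderiv_eq_zero_of_degree_lt ((hp i).1 m hm.symm) (by omega)

theorem mkDerivation_eq_sum [Fintype σ] (f : MvPolynomial σ ℚ) :
    mkDerivation ℚ p f = ∑ i, p i * pderiv i f := by
  classical
  have hs (g : MvPolynomial σ ℚ) :
      (∑ i, p i • (pderiv i : Derivation ℚ (MvPolynomial σ ℚ) (MvPolynomial σ ℚ))) g
        = ∑ i, p i * pderiv i g := by
    have := congrFun (map_sum Derivation.coeFnAddMonoidHom
      (fun i => p i • (pderiv i : Derivation ℚ (MvPolynomial σ ℚ) (MvPolynomial σ ℚ)))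
      Finset.univ) g
    exact this.trans (Finset.sum_apply _ _ _)
  have h : mkDerivation ℚ p = ∑ i, p i • pderiv i := by
    apply derivation_ext
    intro i
    rw [mkDerivation_X, hs]
    simp [pderiv_X, Pi.single_apply]
  rw [h, hs]

theorem HasHomogeneousValues.mkDerivation_of_eq [Fintype σ] (hp : HasHomogeneousValues w d p)
    {f : MvPolynomial σ ℚ} {n m : ℕ} (hf : IsWeightedHomogeneous w f n) (hm : (m : ℤ) = n + d) :
    IsWeightedHomogeneous w (mkDerivation ℚ p f) m := by
  rw [mkDerivation_eq_sum]
  refine IsWeightedHomogeneous.sum _ _ _ fun i _ => ?_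
  by_cases hi : n < w i
  · rw [pderiv_eq_zero_of_degree_lt hf hi, mul_zero]
    exact isWeightedHomogeneous_zero _ _ _
  · have h1 := hf.pderiv (i := i) (n' := n - w i) (by omega)
    by_cases h : (w i : ℤ) + d < 0
    · rw [(hp i).2 h, zero_mul]
      exact isWeightedHomogeneous_zero _ _ _
    · obtain ⟨e, he⟩ := Int.eq_ofNat_of_zero_le (not_lt.1 h)
      have h2 := ((hp i).1 e he.symm).mul h1
      have h3 : e + (n - w i) = m := by omega
      rwa [h3] at h2

theorem HasHomogeneousValues.mkDerivation_of_lt [Fintype σ] (hp : HasHomogeneousValues w d p)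
    {f : MvPolynomial σ ℚ} {n : ℕ} (hf : IsWeightedHomogeneous w f n) (hn : (n : ℤ) + d < 0) :
    mkDerivation ℚ p f = 0 := by
  rw [mkDerivation_eq_sum]
  refine Finset.sum_eq_zero fun i _ => ?_
  by_cases hi : n < w i
  · rw [pderiv_eq_zero_of_degree_lt hf hi, mul_zero]
  · rw [(hp i).2 (by omega), zero_mul]

end HomogeneousDerivation

/-! ### Vanishing criteria for derivations of `H` -/

namespace EllipticPresentation

variable {k : ℕ} {P : EllipticPresentation k} {δ : Derivation ℚ P.Alg P.Alg} {d : ℤ}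

theorem HasDegree.exists_lift (h : P.HasDegree δ d) :
    ∃ p : Fin k → MvPolynomial (Fin k) ℚ, HasHomogeneousValues P.genDeg d p ∧
      ∀ i, Ideal.Quotient.mk P.relIdeal (p i) = δ (Ideal.Quotient.mk P.relIdeal (X i)) := by
  have key : ∀ i, ∃ q : MvPolynomial (Fin k) ℚ,
      ((∀ m : ℕ, (m : ℤ) = P.genDeg i + d → IsWeightedHomogeneous P.genDeg q m) ∧
      ((P.genDeg i : ℤ) + d < 0 → q = 0)) ∧
      Ideal.Quotient.mk P.relIdeal q = δ (Ideal.Quotient.mk P.relIdeal (X i)) := by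
    intro i
    have hx : Ideal.Quotient.mk P.relIdeal (X i) ∈ P.piece (P.genDeg i) :=
      ⟨X i, isWeightedHomogeneous_X ℚ P.genDeg i, rfl⟩
    obtain ⟨h1, h2⟩ := h _ _ hx
    by_cases hneg : (P.genDeg i : ℤ) + d < 0
    · exact ⟨0, ⟨fun m hm => by omega, fun _ => rfl⟩, by rw [h2 hneg, map_zero]⟩
    · obtain ⟨m, hm⟩ := Int.eq_ofNat_of_zero_le (not_lt.1 hneg)
      obtain ⟨q, hq, hq'⟩ := h1 m hm.symm
      refine ⟨q, ⟨fun m' hm' => ?_, fun h => absurd h hneg⟩, hq'⟩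
      have : m' = m := by omega
      rw [this]
      exact hq
  choose p hp using key
  exact ⟨p, fun i => (hp i).1, fun i => (hp i).2⟩

section Lift

variable {p : Fin k → MvPolynomial (Fin k) ℚ}

theorem mk_mkDerivation
    (hlift : ∀ i, Ideal.Quotient.mk P.relIdeal (p i) = δ (Ideal.Quotient.mk P.relIdeal (X i)))
    (f : MvPolynomial (Fin k) ℚ) :
    Ideal.Quotient.mk P.relIdeal (mkDerivation ℚ p f) = δ (Ideal.Quotient.mk P.relIdeal f) := by
  induction f using MvPolynomial.induction_on with
  | C a =>
    rw [derivation_C, map_zero]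
    exact (δ.map_algebraMap a).symm
  | add f g hf hg => simp only [map_add, hf, hg]
  | mul_X f i hf =>
    rw [Derivation.leibniz, map_mul, Derivation.leibniz, mkDerivation_X]
    simp only [smul_eq_mul, map_add, map_mul, hf, hlift]

theorem mkDerivation_mem_relIdeal
    (hlift : ∀ i, Ideal.Quotient.mk P.relIdeal (p i) = δ (Ideal.Quotient.mk P.relIdeal (X i)))
    {f : MvPolynomial (Fin k) ℚ} (hf : f ∈ P.relIdeal) : mkDerivation ℚ p f ∈ P.relIdeal := by
  rw [← Ideal.Quotient.eq_zero_iff_mem, mk_mkDerivation hlift,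
    Ideal.Quotient.eq_zero_iff_mem.2 hf, map_zero]

theorem rel_mem (j : Fin k) : P.rel j ∈ P.relIdeal := Ideal.subset_span ⟨j, rfl⟩

end Lift

/-- A derivation of negative degree vanishes on every element that annihilates it. -/
theorem HasDegree.apply_eq_zero_of_mul_eq_zero (hδ : P.HasDegree δ d) (hd : d < 0) {h : P.Alg}
    (hh : ∀ i, h * δ (Ideal.Quotient.mk P.relIdeal (X i)) = 0) : δ h = 0 := by
  obtain ⟨p, hp, hlift⟩ := hδ.exists_lift
  obtain ⟨f, rfl⟩ := Ideal.Quotient.mk_surjective h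
  rw [← mk_mkDerivation hlift, Ideal.Quotient.eq_zero_iff_mem]
  have hmem : ∀ i, f * p i ∈ Ideal.span (Set.range P.rel) := by
    intro i
    have := hh i
    rw [← hlift, ← map_mul] at this
    exact Ideal.Quotient.eq_zero_iff_mem.1 this
  choose b hb using fun i => (Ideal.mem_span_range_iff_exists_fun).1 (hmem i)
  -- `D uⱼ` has smaller degree than `uⱼ`, so its expansion in the relations can be chosen without
  -- `uⱼ`.
  have hDu : ∀ j, ∃ c : Fin k → MvPolynomial (Fin k) ℚ,
      mkDerivation ℚ p (P.rel j) = ∑ l, c l * P.rel l ∧ c j = 0 := by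
    intro j
    by_cases hneg : (P.relDeg j : ℤ) + d < 0
    · exact ⟨0, by simp [hp.mkDerivation_of_lt (P.rel_homogeneous j) hneg], rfl⟩
    · obtain ⟨m, hm⟩ := Int.eq_ofNat_of_zero_le (not_lt.1 hneg)
      obtain ⟨c, hc, hc'⟩ := exists_homogeneous_coeffs P.rel_homogeneous
        (hp.mkDerivation_of_eq (P.rel_homogeneous j) hm.symm)
        (mkDerivation_mem_relIdeal hlift (P.rel_mem j))
      exact ⟨c, hc, (hc' j).2 (by omega)⟩
  have hdiag : ∀ j, ∑ i, b i j * pderiv i (P.rel j) ∈ P.relIdeal := by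
    intro j
    obtain ⟨c, hc, hcj⟩ := hDu j
    -- Two expansions of `f * D uⱼ` are compared. Their difference is a syzygy whose `j`-th
    -- coefficient is the diagonal sum, because `c j = 0`.
    have hsyz : ∑ l, ((∑ i, b i l * pderiv i (P.rel j)) - f * c l) * P.rel l = 0 := by
      have e1 : f * mkDerivation ℚ p (P.rel j)
          = ∑ l, (∑ i, b i l * pderiv i (P.rel j)) * P.rel l := by
        rw [mkDerivation_eq_sum, Finset.mul_sum]
        have : ∀ i, f * (p i * pderiv i (P.rel j))
            = ∑ l, b i l * pderiv i (P.rel j) * P.rel l := by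
          intro i
          rw [← mul_assoc, ← hb i, Finset.sum_mul]
          exact Finset.sum_congr rfl fun l _ => by ring
        simp only [this, Finset.sum_mul]
        exact Finset.sum_comm
      simp only [sub_mul, Finset.sum_sub_distrib]
      rw [← e1, hc, Finset.mul_sum, ← Finset.sum_sub_distrib]
      exact Finset.sum_eq_zero fun l _ => by ring
    have := P.isRegularFamily.mem_of_sum_eq_zero hsyz j
    rwa [hcj, mul_zero, sub_zero] at this
  -- Zero divergence: `p i * ∂ᵢ f = ∂ᵢ (f * p i)`.
  have hDf : mkDerivation ℚ p f = ∑ i, pderiv i (f * p i) := by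
    rw [mkDerivation_eq_sum]
    refine Finset.sum_congr rfl fun i _ => ?_
    rw [Derivation.leibniz, hp.pderiv_eq_zero hd i, smul_zero, zero_add, smul_eq_mul]
  have hexp : mkDerivation ℚ p f
      = ∑ j, (∑ i, pderiv i (b i j)) * P.rel j + ∑ j, ∑ i, b i j * pderiv i (P.rel j) := by
    rw [hDf]
    have : ∀ i, pderiv i (f * p i)
        = ∑ j, (pderiv i (b i j) * P.rel j + b i j * pderiv i (P.rel j)) := by
      intro i
      rw [← hb i, map_sum]
      refine Finset.sum_congr rfl fun j _ => ?_
      rw [Derivation.leibniz, smul_eq_mul, smul_eq_mul]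
      ring
    simp only [this, Finset.sum_mul]
    rw [Finset.sum_comm, ← Finset.sum_add_distrib]
    exact Finset.sum_congr rfl fun j _ => Finset.sum_add_distrib
  rw [hexp]
  exact Ideal.add_mem _ (Ideal.sum_mem _ fun j _ => Ideal.mul_mem_left _ _ (P.rel_mem j))
    (Ideal.sum_mem _ fun j _ => hdiag j)

/-- If `κ` is a constant of `δ` and all the `κ * δ xᵢ` are scalar multiples of one non-zero
element, then they vanish. -/
theorem HasDegree.coeff_eq_zero_of_rank_one (hδ : P.HasDegree δ d) (hd : d < 0) {κ ω : P.Alg}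
    (hκ : δ κ = 0) (hω : ω ≠ 0) {c : Fin k → ℚ}
    (hc : ∀ i, κ * δ (Ideal.Quotient.mk P.relIdeal (X i)) = c i • ω) (i : Fin k) : c i = 0 := by
  classical
  set x := Ideal.Quotient.mk P.relIdeal (X i) with hx
  have hnil : ∃ n, ω * x ^ n = 0 := by
    obtain ⟨N, hN⟩ := P.X_pow_mem_relIdeal i
    refine ⟨N, ?_⟩
    rw [hx, ← map_pow, Ideal.Quotient.eq_zero_iff_mem.2 hN, mul_zero]
  -- The last power of the nilpotent `x` that does not kill `ω`.
  obtain ⟨n, hn, hmin⟩ : ∃ n, ω * x ^ (n + 1) = 0 ∧ ω * x ^ n ≠ 0 := by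
    have h1 := Nat.find_spec hnil
    rcases hfind : Nat.find hnil with _ | n
    · rw [hfind, pow_zero, mul_one] at h1
      exact absurd h1 hω
    · rw [hfind] at h1
      exact ⟨n, h1, Nat.find_min hnil (by omega)⟩
  -- This element annihilates every `δ xⱼ`, while by Leibniz its derivative is `(n + 1) * c i • (ω *
  -- x ^ n)`.
  have h0 : δ (κ * x ^ (n + 1)) = 0 := by
    apply hδ.apply_eq_zero_of_mul_eq_zero hd
    intro j
    rw [mul_right_comm, hc j, smul_mul_assoc, hn, smul_zero]
  rw [Derivation.leibniz, hκ, smul_zero, add_zero, Derivation.leibniz_pow, Nat.add_sub_cancel,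
    smul_eq_mul, nsmul_eq_mul, smul_eq_mul] at h0
  have h1 : ((n + 1 : ℕ) : P.Alg) * (c i • (ω * x ^ n)) = 0 := by
    rw [← smul_mul_assoc, ← hc i, ← h0]
    ring
  rw [← nsmul_eq_mul, ← Nat.cast_smul_eq_nsmul ℚ, smul_smul, smul_eq_zero] at h1
  rcases h1 with h1 | h1
  · rcases mul_eq_zero.1 h1 with h2 | h2
    · exact absurd h2 (by positivity)
    · exact h2
  · exact absurd h1 hmin

/-- A derivation cannot send a nilpotent generator to a non-zero constant. -/
theorem eq_zero_of_apply_eq_algebraMap {i : Fin k} {c : ℚ}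
    (h : δ (Ideal.Quotient.mk P.relIdeal (X i)) = algebraMap ℚ P.Alg c) : c = 0 := by
  classical
  have : Nontrivial P.Alg := Ideal.Quotient.nontrivial_iff.2 P.relIdeal_ne_top
  set x := Ideal.Quotient.mk P.relIdeal (X i) with hx
  have hnil : ∃ n, x ^ n = 0 := by
    obtain ⟨N, hN⟩ := P.X_pow_mem_relIdeal i
    exact ⟨N, by rw [hx, ← map_pow, Ideal.Quotient.eq_zero_iff_mem.2 hN]⟩
  obtain ⟨n, hn, hmin⟩ : ∃ n, x ^ (n + 1) = 0 ∧ x ^ n ≠ 0 := by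
    have h1 := Nat.find_spec hnil
    rcases hfind : Nat.find hnil with _ | n
    · rw [hfind, pow_zero] at h1
      exact absurd h1 one_ne_zero
    · rw [hfind] at h1
      exact ⟨n, h1, Nat.find_min hnil (by omega)⟩
  have h0 : δ (x ^ (n + 1)) = 0 := by rw [hn, map_zero]
  rw [Derivation.leibniz_pow, Nat.add_sub_cancel, h, smul_eq_mul, mul_comm, ← Algebra.smul_def,
    ← Nat.cast_smul_eq_nsmul ℚ, smul_smul, smul_eq_zero] at h0
  rcases h0 with h1 | h1
  · rcases mul_eq_zero.1 h1 with h2 | h2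
    · exact absurd h2 (by positivity)
    · exact h2
  · exact absurd h1 hmin

theorem derivation_eq_zero (h : ∀ i, δ (Ideal.Quotient.mk P.relIdeal (X i)) = 0) : δ = 0 := by
  ext z
  obtain ⟨f, rfl⟩ := Ideal.Quotient.mk_surjective z
  have h2 := mk_mkDerivation (P := P) (δ := δ) (p := 0) (fun i => by simp [h i]) f
  rw [← h2, mkDerivation_eq_sum]
  simp

end EllipticPresentation

/-! ### Derivations of degree `-2` and the substitution `aeval p` -/

section LinearStep

variable {k : ℕ} {w : Fin k → ℕ} {p : Fin k → MvPolynomial (Fin k) ℚ}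

/-- The generators have degree `2` or `4`, and `p` sends those of degree `2` to zero and those of
degree `4` to linear forms in those of degree `2`. -/
structure IsLinearStep (w : Fin k → ℕ) (p : Fin k → MvPolynomial (Fin k) ℚ) : Prop where
  weight_eq : ∀ i, w i = 2 ∨ w i = 4
  eq_zero : ∀ i, w i = 2 → p i = 0
  homogeneous : ∀ i, IsWeightedHomogeneous w (p i) 2

theorem two_mul_degree_le_weight (hw : ∀ i, 2 ≤ w i) (m : Fin k →₀ ℕ) :
    2 * m.degree ≤ Finsupp.weight w m := by
  rw [Finsupp.weight_apply, Finsupp.degree_apply, Finsupp.sum, Finset.mul_sum]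
  refine Finset.sum_le_sum fun i _ => ?_
  rw [smul_eq_mul, mul_comm]
  exact Nat.mul_le_mul_left _ (hw i)

theorem totalDegree_eq_one_of_homogeneous (hw : ∀ i, 2 ≤ w i) {f : MvPolynomial (Fin k) ℚ}
    (hf : IsWeightedHomogeneous w f 2) (h0 : f ≠ 0) : f.totalDegree = 1 := by
  apply le_antisymm
  · refine Finset.sup_le fun m hm => ?_
    have h1 := two_mul_degree_le_weight hw m
    rw [hf (mem_support_iff.1 hm)] at h1
    have h2 : (m.sum fun _ e => e) = m.degree := rfl
    omega
  · rw [Nat.one_le_iff_ne_zero]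
    intro h
    rw [totalDegree_eq_zero_iff_eq_C] at h
    apply h0
    rw [h, hf.coeff_eq_zero 0 (by simp), C_0]

theorem irreducible_of_homogeneous (hw : ∀ i, 2 ≤ w i) {f : MvPolynomial (Fin k) ℚ}
    (hf : IsWeightedHomogeneous w f 2) (h0 : f ≠ 0) : Irreducible f := by
  refine irreducible_of_totalDegree_eq_one (totalDegree_eq_one_of_homogeneous hw hf h0) ?_
  intro x hx
  rw [isUnit_iff_ne_zero]
  rintro rfl
  apply h0
  ext m
  simpa using hx m

theorem not_dvd_of_homogeneous (hw : ∀ i, 2 ≤ w i) {f g : MvPolynomial (Fin k) ℚ}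
    (hf : IsWeightedHomogeneous w f 2) (hg : IsWeightedHomogeneous w g 2) (h0 : f ≠ 0)
    (hfg : ∀ a : ℚ, g ≠ a • f) : ¬ f ∣ g := by
  rintro ⟨q, hq⟩
  have hg0 : g ≠ 0 := by simpa using hfg 0
  have hq0 : q ≠ 0 := by
    rintro rfl
    exact hg0 (by rw [hq, mul_zero])
  have h1 := totalDegree_mul_of_isDomain h0 hq0
  rw [← hq, totalDegree_eq_one_of_homogeneous hw hf h0,
    totalDegree_eq_one_of_homogeneous hw hg hg0] at h1
  have h2 := (totalDegree_eq_zero_iff_eq_C (p := q)).1 (by omega)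
  apply hfg (coeff 0 q)
  rw [smul_eq_C_mul, ← h2, hq, mul_comm]

/-- Linear forms are irreducible, and non-proportional ones are coprime, hence so are their powers.
-/
theorem isUnit_of_dvd_pow (hw : ∀ i, 2 ≤ w i) {f g q : MvPolynomial (Fin k) ℚ}
    (hf : IsWeightedHomogeneous w f 2) (hg : IsWeightedHomogeneous w g 2) (h0 : f ≠ 0)
    (hfg : ∀ a : ℚ, g ≠ a • f) {m n : ℕ} (h1 : q ∣ f ^ m) (h2 : q ∣ g ^ n) : IsUnit q := by
  have h : IsRelPrime f g :=
    (irreducible_of_homogeneous hw hf h0).isRelPrime_iff_not_dvd.2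
      (not_dvd_of_homogeneous hw hf hg h0 hfg)
  exact (h.pow) h1 h2

/-- If `c ≠ 0`, the prime `f` divides `g ^ 2`, hence `g`. With `c = 0`, cancelling `f` leaves a
linear relation. -/
theorem eq_zero_of_quadratic_relation (hw : ∀ i, 2 ≤ w i) {f g : MvPolynomial (Fin k) ℚ}
    (hf : IsWeightedHomogeneous w f 2) (hg : IsWeightedHomogeneous w g 2) (h0 : f ≠ 0)
    (hfg : ∀ a : ℚ, g ≠ a • f) {a b c : ℚ}
    (h : a • f ^ 2 + b • (f * g) + c • g ^ 2 = 0) : a = 0 ∧ b = 0 ∧ c = 0 := by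
  simp only [smul_eq_C_mul] at h
  have hc : c = 0 := by
    by_contra hc
    have hdvd : f ∣ C c * g ^ 2 := ⟨-(C a * f + C b * g), by linear_combination h⟩
    have hdvd2 : f ∣ g ^ 2 := by
      have := Dvd.dvd.mul_left hdvd (C c⁻¹)
      rwa [← mul_assoc, ← C_mul, inv_mul_cancel₀ hc, C_1, one_mul] at this
    exact not_dvd_of_homogeneous hw hf hg h0 hfg
      ((irreducible_of_homogeneous hw hf h0).prime.dvd_of_dvd_pow hdvd2)
  subst hc
  have h3 : f * (C a * f + C b * g) = 0 := by
    rw [C_0] at h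
    linear_combination h
  have h4 := (mul_eq_zero.1 h3).resolve_left h0
  have hb : b = 0 := by
    by_contra hb
    apply hfg (-(b⁻¹ * a))
    have hbb : (C b⁻¹ : MvPolynomial (Fin k) ℚ) * C b = 1 := by
      rw [← C_mul, inv_mul_cancel₀ hb, C_1]
    rw [smul_eq_C_mul, C_neg, C_mul]
    linear_combination C b⁻¹ * h4 - g * hbb
  subst hb
  refine ⟨?_, rfl, rfl⟩
  rw [C_0, zero_mul, add_zero] at h4
  exact C_eq_zero.1 ((mul_eq_zero.1 h4).resolve_right h0)

namespace IsLinearStep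

theorem two_le (h : IsLinearStep w p) (i : Fin k) : 2 ≤ w i := by
  rcases h.weight_eq i with h | h <;> omega

theorem hasHomogeneousValues (h : IsLinearStep w p) : HasHomogeneousValues w (-2) p := by
  intro i
  rcases h.weight_eq i with hi | hi
  · rw [h.eq_zero i hi]
    exact ⟨fun m _ => isWeightedHomogeneous_zero _ _ _, fun _ => rfl⟩
  · refine ⟨fun m hm => ?_, fun hlt => by omega⟩
    have : m = 2 := by omega
    rw [this]
    exact h.homogeneous i

theorem mkDerivation_homogeneous (h : IsLinearStep w p) {f : MvPolynomial (Fin k) ℚ} {n : ℕ}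
    (hf : IsWeightedHomogeneous w f (n + 2)) : IsWeightedHomogeneous w (mkDerivation ℚ p f) n :=
  h.hasHomogeneousValues.mkDerivation_of_eq hf (by push_cast; ring)

theorem mkDerivation_eq_zero (h : IsLinearStep w p) {f : MvPolynomial (Fin k) ℚ} {n : ℕ}
    (hn : n ≤ 2) (hf : IsWeightedHomogeneous w f n) : mkDerivation ℚ p f = 0 := by
  rw [mkDerivation_eq_sum]
  refine Finset.sum_eq_zero fun i _ => ?_
  rcases h.weight_eq i with hi | hi
  · rw [h.eq_zero i hi, zero_mul]
  · rw [pderiv_eq_zero_of_degree_lt hf (by omega), mul_zero]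

theorem mkDerivation_value (h : IsLinearStep w p) (i : Fin k) : mkDerivation ℚ p (p i) = 0 :=
  h.mkDerivation_eq_zero le_rfl (h.homogeneous i)

/-- In the higher Leibniz rule only two terms survive, as `D` kills `p i = D xᵢ`. -/
theorem iterate_mul_X (h : IsLinearStep w p) (i : Fin k) (f : MvPolynomial (Fin k) ℚ) (n : ℕ) :
    (mkDerivation ℚ p)^[n + 1] (X i * f) = X i * (mkDerivation ℚ p)^[n + 1] f
      + (n + 1 : ℕ) • (p i * (mkDerivation ℚ p)^[n] f) := by
  induction n with
  | zero =>
    simp only [zero_add, Function.iterate_one, Function.iterate_zero, id, one_smul]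
    rw [Derivation.leibniz, mkDerivation_X, smul_eq_mul, smul_eq_mul]
    ring
  | succ n ih =>
    rw [Function.iterate_succ_apply', ih, map_add, map_nsmul, Derivation.leibniz,
      Derivation.leibniz, h.mkDerivation_value, mkDerivation_X, smul_zero, add_zero,
      ← Function.iterate_succ_apply' (mkDerivation ℚ p),
      ← Function.iterate_succ_apply' (mkDerivation ℚ p)]
    simp only [smul_eq_mul, nsmul_eq_mul]
    push_cast
    ring

/-- A factor of degree 4 absorbs at most one `D`, a factor of degree 2 none. Weight below `4 * n`
leaves fewer than `n` factors of degree 4. At weight `4 * n` either all factors have degree 4, and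
`n!` counts the orders of differentiation, or some factor has degree 2 and both sides vanish. -/
theorem iterate_monomial (h : IsLinearStep w p) (N : ℕ) : ∀ s : Fin k →₀ ℕ, s.degree = N →
    ∀ n, (Finsupp.weight w s < 4 * n → (mkDerivation ℚ p)^[n] (monomial s 1) = 0) ∧
      (Finsupp.weight w s = 4 * n →
        (mkDerivation ℚ p)^[n] (monomial s 1) = n.factorial • aeval p (monomial s (1 : ℚ))) := by
  induction N with
  | zero =>
    intro s hs n
    rw [Finsupp.degree_eq_zero_iff] at hs
    subst hs
    rcases n with _ | n
    · simp
    · refine ⟨fun _ => ?_, fun hw => by simp at hw⟩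
      rw [Function.iterate_succ_apply]
      have : mkDerivation ℚ p (monomial 0 1) = 0 :=
        h.mkDerivation_eq_zero (n := 0) (by omega)
          (isWeightedHomogeneous_monomial w 0 1 (by simp))
      rw [this, iterate_map_zero]
  | succ N ih =>
    intro s hs n
    obtain ⟨i, hi⟩ : ∃ i, s i ≠ 0 := by
      by_contra! hall
      have : s = 0 := Finsupp.ext hall
      rw [this] at hs
      simp at hs
    obtain ⟨t, rfl⟩ : ∃ t, s = Finsupp.single i 1 + t :=
      ⟨s - Finsupp.single i 1, by
        rw [add_comm, tsub_add_cancel_of_le]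
        rw [Finsupp.single_le_iff]
        omega⟩
    have ht : t.degree = N := by
      rw [map_add, Finsupp.degree_single] at hs
      omega
    have hmon : (monomial (Finsupp.single i 1 + t) 1 : MvPolynomial (Fin k) ℚ)
        = X i * monomial t 1 := by
      rw [X, monomial_mul, one_mul]
    have hwt : Finsupp.weight w (Finsupp.single i 1 + t) = w i + Finsupp.weight w t := by
      rw [map_add, Finsupp.weight_single, one_smul]
    have hwi := h.two_le i
    rw [hwt, hmon]
    rcases n with _ | n
    · constructor <;> intro hlt <;> omega
    · rw [h.iterate_mul_X, map_mul, aeval_X]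
      rcases h.weight_eq i with h2 | h4
      · rw [h.eq_zero i h2]
        constructor <;> intro hlt <;> rw [(ih t ht (n + 1)).1 (by omega)] <;> simp
      · constructor
        · intro hlt
          rw [(ih t ht (n + 1)).1 (by omega), (ih t ht n).1 (by omega)]
          simp
        · intro heq
          rw [(ih t ht (n + 1)).1 (by omega), (ih t ht n).2 (by omega), Nat.factorial_succ]
          simp only [nsmul_eq_mul]
          push_cast
          ring

theorem iterate_eq_zero (h : IsLinearStep w p) {f : MvPolynomial (Fin k) ℚ} {m n : ℕ}
    (hf : IsWeightedHomogeneous w f m) (hmn : m < 4 * n) : (mkDerivation ℚ p)^[n] f = 0 := by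
  refine IsWeightedHomogeneous.induction_on
    (motive := fun f _ => (mkDerivation ℚ p)^[n] f = 0) ?_ ?_ ?_ hf
  · exact iterate_map_zero _ _
  · intro f g _ _ hf hg
    rw [iterate_map_add, hf, hg, add_zero]
  · intro s r hs
    have : (monomial s r : MvPolynomial (Fin k) ℚ) = r • monomial s 1 := by
      rw [smul_monomial, smul_eq_mul, mul_one]
    rw [this, Function.Commute.iterate_left (g := fun x => r • x)
      (fun x => Derivation.map_smul (mkDerivation ℚ p) r x) n, (h.iterate_monomial _ s rfl n).1 (by omega)]
    exact smul_zero r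

theorem iterate_eq_aeval (h : IsLinearStep w p) {f : MvPolynomial (Fin k) ℚ} {n : ℕ}
    (hf : IsWeightedHomogeneous w f (4 * n)) :
    (mkDerivation ℚ p)^[n] f = n.factorial • aeval p f := by
  refine IsWeightedHomogeneous.induction_on
    (motive := fun f _ => (mkDerivation ℚ p)^[n] f = n.factorial • aeval p f) ?_ ?_ ?_ hf
  · rw [iterate_map_zero, map_zero, smul_zero]
  · intro f g _ _ hf hg
    rw [iterate_map_add, hf, hg, map_add, smul_add]
  · intro s r hs
    have : (monomial s r : MvPolynomial (Fin k) ℚ) = r • monomial s 1 := by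
      rw [smul_monomial, smul_eq_mul, mul_one]
    rw [this, Function.Commute.iterate_left (g := fun x => r • x)
      (fun x => Derivation.map_smul (mkDerivation ℚ p) r x) n, (h.iterate_monomial _ s rfl n).2 hs,
      map_smul]
    exact smul_comm _ _ _

theorem aeval_monomial_eq_zero (h : IsLinearStep w p) {s : Fin k →₀ ℕ} (r : ℚ) {i : Fin k}
    (hi : w i = 2) (hs : s i ≠ 0) : aeval p (monomial s r) = 0 := by
  rw [aeval_monomial, Finsupp.prod, Finset.prod_eq_zero (Finsupp.mem_support_iff.2 hs), mul_zero]
  rw [h.eq_zero i hi, zero_pow hs]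

theorem aeval_eq_zero_of_not_dvd (h : IsLinearStep w p) {f : MvPolynomial (Fin k) ℚ} {m : ℕ}
    (hf : IsWeightedHomogeneous w f m) (hm : ¬ 4 ∣ m) : aeval p f = 0 := by
  refine IsWeightedHomogeneous.induction_on (motive := fun f _ => aeval p f = 0) ?_ ?_ ?_ hf
  · exact map_zero _
  · intro f g _ _ hf hg
    rw [map_add, hf, hg, add_zero]
  · intro s r hs
    obtain ⟨i, hi, hsi⟩ : ∃ i, w i = 2 ∧ s i ≠ 0 := by
      by_contra! hall
      apply hm
      rw [← hs, Finsupp.weight_apply, Finsupp.sum]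
      refine Finset.dvd_sum fun i hi => ?_
      rcases h.weight_eq i with h2 | h4
      · rw [hall i h2, zero_smul]
        exact dvd_zero _
      · rw [h4, smul_eq_mul]
        exact Dvd.intro_left _ rfl
    exact h.aeval_monomial_eq_zero r hi hsi

theorem aeval_mem_span_mul (h : IsLinearStep w p) {f : MvPolynomial (Fin k) ℚ}
    (hf : IsWeightedHomogeneous w f 8) :
    aeval p f ∈ Submodule.span ℚ {q | ∃ i j, w i = 4 ∧ w j = 4 ∧ q = p i * p j} := by
  set V := Submodule.span ℚ {q | ∃ i j, w i = 4 ∧ w j = 4 ∧ q = p i * p j}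
  refine IsWeightedHomogeneous.induction_on (motive := fun f _ => aeval p f ∈ V) ?_ ?_ ?_ hf
  · rw [map_zero]
    exact V.zero_mem
  · intro f g _ _ hf hg
    rw [map_add]
    exact V.add_mem hf hg
  · intro s r hs
    by_cases hall : ∃ i, w i = 2 ∧ s i ≠ 0
    · obtain ⟨i, hi, hsi⟩ := hall
      rw [h.aeval_monomial_eq_zero r hi hsi]
      exact V.zero_mem
    · have hs4 : ∀ i, s i ≠ 0 → w i = 4 := fun i hsi =>
        (h.weight_eq i).resolve_left fun h2 => hall ⟨i, h2, hsi⟩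
      have hex : ∀ t : Fin k →₀ ℕ, Finsupp.weight w t ≠ 0 → ∃ i u, t = Finsupp.single i 1 + u := by
        intro t ht
        obtain ⟨i, hi⟩ : ∃ i, t i ≠ 0 := by
          by_contra! hall
          rw [Finsupp.ext (g := 0) hall] at ht
          simp at ht
        exact ⟨i, t - Finsupp.single i 1, by
          rw [add_comm, tsub_add_cancel_of_le]
          rw [Finsupp.single_le_iff]
          omega⟩
      have hadd : ∀ i (u : Fin k →₀ ℕ), Finsupp.weight w (Finsupp.single i 1 + u)
          = w i + Finsupp.weight w u := by
        intro i u
        rw [map_add, Finsupp.weight_single, one_smul]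
      obtain ⟨i, u, rfl⟩ := hex s (by omega)
      have hi : w i = 4 := hs4 i (by simp)
      rw [hadd, hi] at hs
      obtain ⟨j, v, rfl⟩ := hex u (by omega)
      have hj : w j = 4 := hs4 j (by simp)
      rw [hadd, hj] at hs
      have hv : v = 0 := by
        by_contra hv
        obtain ⟨l, hl⟩ : ∃ l, v l ≠ 0 := by
          by_contra! hall
          exact hv (Finsupp.ext hall)
        obtain ⟨l, v', rfl⟩ := hex v (by
          have := two_mul_degree_le_weight h.two_le v
          have h0 : v.degree ≠ 0 := by rwa [Ne, Finsupp.degree_eq_zero_iff]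
          omega)
        rw [hadd] at hs
        have := h.two_le l
        omega
      subst hv
      have hmon : (monomial (Finsupp.single i 1 + (Finsupp.single j 1 + 0)) r :
          MvPolynomial (Fin k) ℚ) = r • (X i * X j) := by
        rw [add_zero, X, X, monomial_mul, smul_monomial]
        simp
      rw [hmon, map_smul, map_mul, aeval_X, aeval_X]
      exact V.smul_mem _ (Submodule.subset_span ⟨i, j, hi, hj, rfl⟩)

end IsLinearStep

end LinearStep

/-! ### Degree bookkeeping under `∑ (b i - g i) ≤ 20` -/

section Counting

variable {k : ℕ} {g b : Fin k → ℕ}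

theorem sum_map_sub_le {n : ℕ} (hle : ∀ i, g i ≤ b i) (h : ∑ i, b i ≤ n + ∑ i, g i)
    {l : List (Fin k)} (hl : l.Nodup) : (l.map fun i => b i - g i).sum ≤ n := by
  rw [← List.sum_toFinset _ hl]
  have h1 : ∑ i ∈ l.toFinset, (b i - g i) ≤ ∑ i, (b i - g i) :=
    Finset.sum_le_sum_of_subset (Finset.subset_univ _)
  have h2 : ∑ i, (b i - g i) + ∑ i, g i = ∑ i, b i := by
    rw [← Finset.sum_add_distrib]
    exact Finset.sum_congr rfl fun i _ => Nat.sub_add_cancel (hle i)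
  omega

/-- The numerical hypotheses on the degrees of generators and relations. -/
structure IsSmall (g b : Fin k → ℕ) (y z : Fin k) : Prop where
  gen : ∀ i, g i = 2 ∨ g i = 4
  two_mul_le : ∀ i, 2 * g i ≤ b i
  ne : y ≠ z
  gen_left : g y = 4
  gen_right : g z = 4
  le_right : ∀ i, b i ≤ b z
  le_left : ∀ i, i ≠ z → b i ≤ b y
  sum_le : ∑ i, b i ≤ 20 + ∑ i, g i

namespace IsSmall

variable {y z : Fin k}

theorem list_sum_le (h : IsSmall g b y z) {l : List (Fin k)} (hl : l.Nodup) :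
    (l.map fun i => b i - g i).sum ≤ 20 :=
  sum_map_sub_le (fun i => by have := h.two_mul_le i; omega) h.sum_le hl

/-- The relations at `y` and `z` have degree at least 12 and cost at least `8 + 8`. The index `x`
costs at least 2, so `b z ≤ 14`, and divisibility by 4 leaves 12. The remaining 4 cannot pay for
degree 10 (at least 6), nor for degrees 6 and 4 together (`4 + 2`). -/
theorem of_two_large (h : IsSmall g b y z) {x i j : Fin k} (hx : g x = 2) (hij : i ≠ j)
    (hi : 12 ≤ b i) (hj : 12 ≤ b j) (hdvd : 4 ∣ b i) :
    b i = 12 ∧ (∀ l, b l ≠ 10) ∧ ∀ l l', b l = 6 → b l' ≠ 4 := by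
  have hgy := h.gen_left
  have hgz := h.gen_right
  have hz : 12 ≤ b z := hi.trans (h.le_right i)
  have hy : 12 ≤ b y := by
    by_cases hiz : i = z
    · exact hj.trans (h.le_left j fun hjz => hij (hiz.trans hjz.symm))
    · exact hi.trans (h.le_left i hiz)
  have hxy : x ≠ y := fun e => by rw [e] at hx; omega
  have hxz : x ≠ z := fun e => by rw [e] at hx; omega
  have hyz := h.ne
  have hbx := h.two_mul_le x
  have hiz := h.le_right i
  refine ⟨?_, fun l hl => ?_, fun l l' hl hl' => ?_⟩
  · have := h.list_sum_le (l := [y, z, x]) (by simp [hyz, hxy.symm, hxz.symm])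
    simp only [List.map_cons, List.map_nil, List.sum_cons, List.sum_nil] at this
    omega
  · have hly : y ≠ l := fun e => by rw [← e] at hl; omega
    have hlz : z ≠ l := fun e => by rw [← e] at hl; omega
    have := h.list_sum_le (l := [y, z, l]) (by simp [hyz, hly, hlz])
    simp only [List.map_cons, List.map_nil, List.sum_cons, List.sum_nil] at this
    have := h.gen l
    omega
  · have hly : y ≠ l := fun e => by rw [← e] at hl; omega
    have hlz : z ≠ l := fun e => by rw [← e] at hl; omega
    have hly' : y ≠ l' := fun e => by rw [← e] at hl'; omega
    have hlz' : z ≠ l' := fun e => by rw [← e] at hl'; omega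
    have hll : l ≠ l' := fun e => by rw [← e] at hl'; omega
    have := h.list_sum_le (l := [y, z, l, l']) (by simp [hyz, hly, hlz, hly', hlz', hll])
    simp only [List.map_cons, List.map_nil, List.sum_cons, List.sum_nil] at this
    have := h.gen l
    have := h.gen l'
    have := h.two_mul_le l
    have := h.two_mul_le l'
    omega

/-- The indices `z`, `y`, `l₃`, `l₂` cost at least `8 + 4 + 4 + 2 = 18`. The remaining 2 excludes
degree 16, a relation of degree 10 and a second one of degree 6. If `y` itself has degree 10, then
`j` is a fifth index and exceeds the budget. -/
theorem of_one_large (h : IsSmall g b y z) {l₂ l₃ j i : Fin k} (h₂ : b l₂ = 4) (h₃ : b l₃ = 6)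
    (hj : b j = 8) (hi : 12 ≤ b i) (hdvd : 4 ∣ b i) :
    b i = 12 ∧ (∀ l, b l ≠ 10) ∧ ∀ l, b l = 6 → l = l₃ := by
  have hgy := h.gen_left
  have hgz := h.gen_right
  have hz : 12 ≤ b z := hi.trans (h.le_right i)
  have hby := h.two_mul_le y
  have hyz := h.ne
  have hiz := h.le_right i
  have hy2 : y ≠ l₂ := fun e => by rw [← e] at h₂; omega
  have hz2 : z ≠ l₂ := fun e => by rw [← e] at h₂; omega
  have hy3 : y ≠ l₃ := fun e => by rw [← e] at h₃; omega
  have hz3 : z ≠ l₃ := fun e => by rw [← e] at h₃; omega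
  have h23 : l₂ ≠ l₃ := fun e => by rw [← e] at h₃; omega
  have hg2 := h.gen l₂
  have hg3 := h.gen l₃
  have hb2 := h.two_mul_le l₂
  have hb3 := h.two_mul_le l₃
  have key : ∀ l, y ≠ l → z ≠ l → l₂ ≠ l → l₃ ≠ l → b y + b z + (b l - g l) ≤ 22 := by
    intro l h1 h2 h3 h4
    have := h.list_sum_le (l := [y, z, l₂, l₃, l])
      (by simp [hyz, hy2, hz2, hy3, hz3, h23, h1, h2, h3, h4])
    simp only [List.map_cons, List.map_nil, List.sum_cons, List.sum_nil] at this
    omega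
  refine ⟨?_, fun l hl => ?_, fun l hl => ?_⟩
  · have := h.list_sum_le (l := [y, z, l₂, l₃]) (by simp [hyz, hy2, hz2, hy3, hz3, h23])
    simp only [List.map_cons, List.map_nil, List.sum_cons, List.sum_nil] at this
    omega
  · have hlz : z ≠ l := fun e => by rw [← e] at hl; omega
    have hl2 : l₂ ≠ l := fun e => by rw [← e] at hl; omega
    have hl3 : l₃ ≠ l := fun e => by rw [← e] at hl; omega
    by_cases hly : y = l
    · subst hly
      have := key j (fun e => by rw [← e] at hj; omega) (fun e => by rw [← e] at hj; omega)
        (fun e => by rw [← e] at hj; omega) (fun e => by rw [← e] at hj; omega)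
      have := h.gen j
      omega
    · have := key l hly hlz hl2 hl3
      have := h.gen l
      omega
  · by_contra hne
    have := key l (fun e => by rw [← e] at hl; omega) (fun e => by rw [← e] at hl; omega)
      (fun e => by rw [← e] at hl; omega) (Ne.symm hne)
    have := h.gen l
    have := h.two_mul_le l
    omega

theorem card_of_two_le (h : IsSmall g b y z)
    (h4 : 2 ≤ (Finset.univ.filter fun i => b i = 4).card)
    (h6 : 2 ≤ (Finset.univ.filter fun i => b i = 6).card) :
    (Finset.univ.filter fun i => b i = 4).card = 2 ∧
      (Finset.univ.filter fun i => g i = 4).card = 2 := by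
  have hg : 2 ≤ (Finset.univ.filter fun i => g i = 4).card := by
    rw [← Finset.card_pair h.ne]
    apply Finset.card_le_card
    intro i hi
    rw [Finset.mem_insert, Finset.mem_singleton] at hi
    rcases hi with rfl | rfl
    · simp [h.gen_left]
    · simp [h.gen_right]
  -- The weights are lower bounds for `b i - g i` in each case. The three counts then satisfy `2A +
  -- 4B + 4G ≤ 20`, with equality when all are 2.
  have hpt : ∑ i, ((if b i = 4 then 2 else 0) + (if b i = 6 then 4 else 0)
      + (if g i = 4 then 4 else 0) + g i) ≤ ∑ i, b i := by
    refine Finset.sum_le_sum fun i _ => ?_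
    have h1 := h.gen i
    have h2 := h.two_mul_le i
    split_ifs <;> omega
  simp only [Finset.sum_add_distrib, ← Finset.sum_filter, Finset.sum_const, smul_eq_mul] at hpt
  have := h.sum_le
  omega

end IsSmall

end Counting

/-! ### Relations under `D` and under the substitution -/

theorem two_le_card_of_mem_span {V ι : Type*} [AddCommGroup V] [Module ℚ V] (S : Finset ι)
    (e : ι → V) {v₀ v₁ : V} (h₀ : v₀ ∈ Submodule.span ℚ (e '' S))
    (h₁ : v₁ ∈ Submodule.span ℚ (e '' S)) (hne : v₀ ≠ 0) (hind : ∀ a : ℚ, v₁ ≠ a • v₀) :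
    2 ≤ S.card := by
  classical
  have hli : LinearIndependent ℚ ![v₀, v₁] :=
    (LinearIndependent.pair_iff' hne).2 fun a => (hind a).symm
  have h2 := finrank_span_eq_card hli
  have hle : Submodule.span ℚ (Set.range ![v₀, v₁]) ≤ Submodule.span ℚ (e '' S) := by
    rw [Submodule.span_le]
    rintro _ ⟨i, rfl⟩
    fin_cases i
    · exact h₀
    · exact h₁
  have : FiniteDimensional ℚ (Submodule.span ℚ (e '' S)) :=
    FiniteDimensional.span_of_finite ℚ (S.finite_toSet.image e)
  have h3 := Submodule.finrank_mono hle
  have h4 : Module.finrank ℚ (Submodule.span ℚ (e '' S)) ≤ S.card := by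
    rw [← Finset.coe_image]
    exact (finrank_span_finset_le_card _).trans Finset.card_image_le
  rw [h2] at h3
  simpa using h3.trans h4

namespace EllipticPresentation

variable {k : ℕ} {P : EllipticPresentation k} {p : Fin k → MvPolynomial (Fin k) ℚ}

theorem mkDerivation_twice_mul (c u : MvPolynomial (Fin k) ℚ) :
    mkDerivation ℚ p (mkDerivation ℚ p (c * u))
      = mkDerivation ℚ p (mkDerivation ℚ p c) * u
        + 2 * (mkDerivation ℚ p c * mkDerivation ℚ p u)
        + c * mkDerivation ℚ p (mkDerivation ℚ p u) := by
  simp only [Derivation.leibniz, map_add, smul_eq_mul]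
  ring

/-- `p` are the values of a derivation of degree `-2` that preserves the ideal of relations, all
of which have degree at least `4`. -/
structure IsStep (P : EllipticPresentation k) (p : Fin k → MvPolynomial (Fin k) ℚ) : Prop
    extends IsLinearStep P.genDeg p where
  map_mem : ∀ f ∈ P.relIdeal, mkDerivation ℚ p f ∈ P.relIdeal
  four_le : ∀ j, 4 ≤ P.relDeg j

namespace IsStep

theorem eq_zero_of_mem (h : IsStep P p) {f : MvPolynomial (Fin k) ℚ} {n : ℕ}
    (hf : IsWeightedHomogeneous P.genDeg f n) (hmem : f ∈ P.relIdeal) (hn : n < 4) : f = 0 := by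
  obtain ⟨c, hc, hc'⟩ := exists_homogeneous_coeffs P.rel_homogeneous hf hmem
  rw [hc]
  refine Finset.sum_eq_zero fun i _ => ?_
  rw [(hc' i).2 (by have := h.four_le i; omega), zero_mul]

theorem exists_eq_C {w : Fin k → ℕ} (hw : ∀ i, w i ≠ 0) {f : MvPolynomial (Fin k) ℚ}
    (hf : IsWeightedHomogeneous w f 0) : f = C (coeff 0 f) := by
  have h1 := weightedHomogeneousComponent_zero (w := w) f hw
  rwa [hf.weightedHomogeneousComponent_same] at h1

theorem mem_span_rel (h : IsStep P p) {f : MvPolynomial (Fin k) ℚ}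
    (hf : IsWeightedHomogeneous P.genDeg f 4) (hmem : f ∈ P.relIdeal) :
    f ∈ Submodule.span ℚ
      (P.rel '' (Finset.univ.filter fun i => P.relDeg i = 4 : Finset (Fin k))) := by
  obtain ⟨c, hc, hc'⟩ := exists_homogeneous_coeffs P.rel_homogeneous hf hmem
  rw [hc]
  refine Submodule.sum_mem _ fun i _ => ?_
  rcases (h.four_le i).eq_or_lt with h4 | h4
  · have h0 := (hc' i).1
    rw [← h4] at h0
    rw [exists_eq_C P.genDeg_ne_zero h0, ← smul_eq_C_mul]
    exact Submodule.smul_mem _ _ (Submodule.subset_span ⟨i, by simp [h4.symm], rfl⟩)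
  · rw [(hc' i).2 h4, zero_mul]
    exact Submodule.zero_mem _

theorem map_rel_eq_zero (h : IsStep P p) {l : Fin k} (hl : P.relDeg l = 4) :
    mkDerivation ℚ p (P.rel l) = 0 := by
  have hhom := P.rel_homogeneous l
  rw [hl] at hhom
  exact h.eq_zero_of_mem (h.mkDerivation_homogeneous (n := 2) hhom) (h.map_mem _ (P.rel_mem l))
    (by norm_num)

/-- Only relations of degree 6 contribute: `D` kills those of degree 4 together with their
coefficients of degree 2. -/
theorem map_mem_span (h : IsStep P p) {f : MvPolynomial (Fin k) ℚ}
    (hf : IsWeightedHomogeneous P.genDeg f 6) (hmem : f ∈ P.relIdeal) :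
    mkDerivation ℚ p f ∈ Submodule.span ℚ ((fun i => mkDerivation ℚ p (P.rel i)) ''
      (Finset.univ.filter fun i => P.relDeg i = 6 : Finset (Fin k))) := by
  obtain ⟨c, hc, hc'⟩ := exists_homogeneous_coeffs P.rel_homogeneous hf hmem
  rw [hc, map_sum]
  refine Submodule.sum_mem _ fun i _ => ?_
  have h4 := h.four_le i
  by_cases h6 : P.relDeg i = 6
  · have h0 := (hc' i).1
    rw [h6] at h0
    rw [exists_eq_C P.genDeg_ne_zero h0, ← smul_eq_C_mul, Derivation.map_smul]
    exact Submodule.smul_mem _ _ (Submodule.subset_span ⟨i, by simp [h6], rfl⟩)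
  · convert Submodule.zero_mem _
    by_cases hgt : 6 < P.relDeg i
    · rw [(hc' i).2 hgt, zero_mul, map_zero]
    · obtain ⟨r, hr⟩ := P.relDeg_even i
      have h4' : P.relDeg i = 4 := by omega
      rw [Derivation.leibniz, h.map_rel_eq_zero h4',
        h.mkDerivation_eq_zero (n := 6 - P.relDeg i) (by omega) (hc' i).1, smul_zero, smul_zero,
        add_zero]

theorem map_map_rel (h : IsStep P p) {j : Fin k} (hj : P.relDeg j = 8) :
    mkDerivation ℚ p (mkDerivation ℚ p (P.rel j)) = (2 : ℚ) • aeval p (P.rel j) := by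
  have hhom := P.rel_homogeneous j
  rw [hj] at hhom
  have := h.iterate_eq_aeval (n := 2) hhom
  rw [← Nat.cast_smul_eq_nsmul ℚ] at this
  exact_mod_cast this

theorem aeval_rel_eq_zero (h : IsStep P p) {j : Fin k} (hj : P.relDeg j = 4) :
    aeval p (P.rel j) = 0 := by
  have hhom := P.rel_homogeneous j
  rw [hj] at hhom
  have := h.iterate_eq_aeval (n := 1) hhom
  rw [Function.iterate_one, h.map_rel_eq_zero hj, Nat.factorial_one, one_smul] at this
  exact this.symm

theorem map_rel_homogeneous (h : IsStep P p) {j : Fin k} {n : ℕ} (hj : P.relDeg j = n + 2) :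
    IsWeightedHomogeneous P.genDeg (mkDerivation ℚ p (P.rel j)) n := by
  have hhom := P.rel_homogeneous j
  rw [hj] at hhom
  exact h.mkDerivation_homogeneous hhom

theorem aeval_rel_homogeneous (h : IsStep P p) {j : Fin k} (hj : P.relDeg j = 8) :
    IsWeightedHomogeneous P.genDeg (aeval p (P.rel j)) 4 := by
  have h2 := h.mkDerivation_homogeneous (n := 4) (h.map_rel_homogeneous (n := 6) hj)
  rw [h.map_map_rel hj] at h2
  have h3 := h2.C_mul 2⁻¹
  rw [← smul_eq_C_mul, smul_smul, inv_mul_cancel₀ two_ne_zero, one_smul] at h3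
  exact h3

theorem aeval_rel_mem (h : IsStep P p) {j : Fin k} (hj : P.relDeg j = 8) :
    aeval p (P.rel j) ∈ P.relIdeal := by
  have h2 := h.map_mem _ (h.map_mem _ (P.rel_mem j))
  rw [h.map_map_rel hj, smul_eq_C_mul] at h2
  have h3 := Ideal.mul_mem_left _ (C 2⁻¹) h2
  rwa [← mul_assoc, ← C_mul, inv_mul_cancel₀ two_ne_zero, C_1, one_mul] at h3

theorem aeval_rel_mem_span_of_map (h : IsStep P p) {j : Fin k} (hj : P.relDeg j = 8) :
    aeval p (P.rel j) ∈ Submodule.span ℚ ((fun i => mkDerivation ℚ p (P.rel i)) ''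
      (Finset.univ.filter fun i => P.relDeg i = 6 : Finset (Fin k))) := by
  have h2 := h.map_mem_span (h.map_rel_homogeneous (n := 6) hj) (h.map_mem _ (P.rel_mem j))
  rw [h.map_map_rel hj] at h2
  have h3 := Submodule.smul_mem _ (2⁻¹ : ℚ) h2
  rwa [smul_smul, inv_mul_cancel₀ two_ne_zero, one_smul] at h3

/-- If a relation has degree `12`, its image under `p` is controlled by the relations of
degrees `6` and `8`. -/
theorem aeval_rel_mem_of_relDeg_eq (h : IsStep P p) {q : MvPolynomial (Fin k) ℚ}
    (h10 : ∀ l, P.relDeg l ≠ 10)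
    (h6 : ∀ l, P.relDeg l = 6 → mkDerivation ℚ p (P.rel l) ∈ Ideal.span {q})
    (h8 : ∀ l, P.relDeg l = 8 → aeval p (P.rel l) ∈ Ideal.span {q})
    {j : Fin k} (hj : P.relDeg j = 12) : aeval p (P.rel j) ∈ Ideal.span {q} := by
  obtain ⟨c, hc, hc'⟩ := exists_homogeneous_coeffs P.rel_homogeneous
    (h.map_rel_homogeneous (n := 10) hj) (h.map_mem _ (P.rel_mem j))
  have hmem : mkDerivation ℚ p (mkDerivation ℚ p (mkDerivation ℚ p (P.rel j)))
      ∈ Ideal.span {q} := by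
    rw [hc, map_sum, map_sum]
    refine Ideal.sum_mem _ fun i _ => ?_
    have hi4 := h.four_le i
    have hi10 := h10 i
    obtain ⟨r, hr⟩ := P.relDeg_even i
    by_cases hgt : 10 < P.relDeg i
    · rw [(hc' i).2 hgt, zero_mul, map_zero, map_zero]
      exact Ideal.zero_mem _
    -- As `c i` has degree at most 6, `D² c = 0`. For `uᵢ` of degree 4 the rest vanishes too. Degree
    -- 6 leaves `2 * D c * D uᵢ`, and degree 8 leaves `c * D² uᵢ = 2 * c * φ(uᵢ)`.
    rw [mkDerivation_twice_mul]
    have hcases : P.relDeg i = 4 ∨ P.relDeg i = 6 ∨ P.relDeg i = 8 := by omega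
    have hcz : mkDerivation ℚ p (mkDerivation ℚ p (c i)) = 0 :=
      h.iterate_eq_zero (n := 2) (hc' i).1 (by omega)
    rw [hcz, zero_mul, zero_add]
    rcases hcases with e | e | e
    · rw [h.map_rel_eq_zero e, map_zero, mul_zero, mul_zero, mul_zero, add_zero]
      exact Ideal.zero_mem _
    · have : mkDerivation ℚ p (mkDerivation ℚ p (P.rel i)) = 0 :=
        h.iterate_eq_zero (n := 2) (P.rel_homogeneous i) (by omega)
      rw [this, mul_zero, add_zero]
      exact Ideal.mul_mem_left _ _ (Ideal.mul_mem_left _ _ (h6 i e))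
    · have h1 : mkDerivation ℚ p (c i) = 0 :=
        h.mkDerivation_eq_zero (n := 10 - P.relDeg i) (by omega) (hc' i).1
      rw [h1, zero_mul, mul_zero, zero_add, h.map_map_rel e, smul_eq_C_mul]
      exact Ideal.mul_mem_left _ _ (Ideal.mul_mem_left _ _ (h8 i e))
  have hhom := P.rel_homogeneous j
  rw [hj] at hhom
  have h3 : mkDerivation ℚ p (mkDerivation ℚ p (mkDerivation ℚ p (P.rel j)))
      = 6 • aeval p (P.rel j) := h.iterate_eq_aeval (n := 3) hhom
  rw [h3, ← Nat.cast_smul_eq_nsmul ℚ, smul_eq_C_mul] at hmem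
  have h4 := Ideal.mul_mem_left _ (C 6⁻¹) hmem
  rw [← mul_assoc, ← C_mul] at h4
  norm_num at h4
  exact h4

/-- The forms `p i` have no constant term, so the substitution preserves constant terms, and a
relation has none. -/
theorem aeval_rel_not_isUnit (h : IsStep P p) (j : Fin k) : ¬ IsUnit (aeval p (P.rel j)) := by
  have hcc : (constantCoeff.comp (aeval p : MvPolynomial (Fin k) ℚ →ₐ[ℚ] _).toRingHom :
      MvPolynomial (Fin k) ℚ →+* ℚ) = constantCoeff := by
    apply MvPolynomial.ringHom_ext
    · intro r
      simp
    · intro i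
      have : constantCoeff (p i) = 0 := (h.homogeneous i).coeff_eq_zero 0 (by simp)
      simpa using this
  intro hu
  have h1 := hu.map (constantCoeff : MvPolynomial (Fin k) ℚ →+* ℚ)
  have h2 : constantCoeff (aeval p (P.rel j)) = constantCoeff (P.rel j) :=
    congrArg (fun f : MvPolynomial (Fin k) ℚ →+* ℚ => f (P.rel j)) hcc
  have h3 : constantCoeff (P.rel j) = 0 :=
    (P.rel_homogeneous j).coeff_eq_zero 0 (by have := P.relDeg_pos j; simp; omega)
  rw [h2, h3] at h1
  exact not_isUnit_zero h1

/-- A common divisor `q` of all `φ(uⱼ)` divides a power of every `p i`, since a power of `xᵢ` lies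
in `I`. Powers of `p c` and `p d` are coprime. -/
theorem exists_aeval_rel_notMem (h : IsStep P p) {c d : Fin k} (hc : p c ≠ 0)
    (hcd : ∀ a : ℚ, p d ≠ a • p c) {q : MvPolynomial (Fin k) ℚ} (hq : ¬ IsUnit q) :
    ∃ j, aeval p (P.rel j) ∉ Ideal.span {q} := by
  by_contra! hall
  apply hq
  have hle : P.relIdeal ≤ (Ideal.span {q}).comap (aeval p : MvPolynomial (Fin k) ℚ →ₐ[ℚ] _) := by
    rw [relIdeal, Ideal.span_le]
    rintro _ ⟨j, rfl⟩
    exact hall j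
  have hdvd : ∀ i, ∃ n, q ∣ p i ^ n := by
    intro i
    obtain ⟨n, hn⟩ := P.X_pow_mem_relIdeal i
    refine ⟨n, ?_⟩
    have := hle hn
    rwa [Ideal.mem_comap, map_pow, aeval_X, Ideal.mem_span_singleton] at this
  obtain ⟨m, hm⟩ := hdvd c
  obtain ⟨n, hn⟩ := hdvd d
  exact isUnit_of_dvd_pow h.two_le (h.homogeneous c) (h.homogeneous d) hc hcd hm hn

end IsStep

end EllipticPresentation

/-! ### The products `p i * p j` span a line in `H` -/

namespace EllipticPresentation

variable {k : ℕ} {P : EllipticPresentation k} {p : Fin k → MvPolynomial (Fin k) ℚ}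

namespace IsStep

theorem exists_genDeg_eq_two (h : IsStep P p) {c : Fin k} (hc : p c ≠ 0) :
    ∃ x, P.genDeg x = 2 := by
  by_contra! hall
  obtain ⟨m, hm⟩ := MvPolynomial.ne_zero_iff.1 hc
  have hw := (h.homogeneous c) hm
  have h0 : 4 ∣ Finsupp.weight P.genDeg m := by
    rw [Finsupp.weight_apply, Finsupp.sum]
    refine Finset.dvd_sum fun i _ => ?_
    rw [(h.weight_eq i).resolve_left (hall i), smul_eq_mul]
    exact Dvd.intro_left _ rfl
  rw [hw] at h0
  omega

theorem four_dvd_of_aeval_ne_zero (h : IsStep P p) {j : Fin k} (hj : aeval p (P.rel j) ≠ 0) :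
    4 ∣ P.relDeg j := by
  by_contra hn
  exact hj (h.aeval_eq_zero_of_not_dvd (P.rel_homogeneous j) hn)

theorem twelve_le (h : IsStep P p) {j : Fin k} (hj : aeval p (P.rel j) ≠ 0)
    (h8 : P.relDeg j ≠ 8) : 12 ≤ P.relDeg j := by
  have h1 := h.four_dvd_of_aeval_ne_zero hj
  have h2 : P.relDeg j ≠ 4 := fun e => hj (h.aeval_rel_eq_zero e)
  have h3 := h.four_le j
  omega

/-- In small formal dimension, some relation of degree `8` has a non-zero image. -/
theorem exists_relDeg_eq_eight (h : IsStep P p) {y z : Fin k}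
    (hs : IsSmall P.genDeg P.relDeg y z) {c d : Fin k} (hc : p c ≠ 0)
    (hcd : ∀ a : ℚ, p d ≠ a • p c) : ∃ j, P.relDeg j = 8 ∧ aeval p (P.rel j) ≠ 0 := by
  by_contra! h8
  obtain ⟨x, hx⟩ := h.exists_genDeg_eq_two hc
  -- Taking `q = 0` gives a non-zero image; taking `q` to be that image gives a second relation.
  -- Without degree 8 both have degree at least 12.
  obtain ⟨i, hi⟩ := h.exists_aeval_rel_notMem hc hcd (q := 0) not_isUnit_zero
  have hi0 : aeval p (P.rel i) ≠ 0 := fun e => hi (by rw [e]; exact Ideal.zero_mem _)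
  obtain ⟨j, hj⟩ := h.exists_aeval_rel_notMem hc hcd (h.aeval_rel_not_isUnit i)
  have hj0 : aeval p (P.rel j) ≠ 0 := fun e => hj (by rw [e]; exact Ideal.zero_mem _)
  have hij : i ≠ j := by
    rintro rfl
    exact hj (Ideal.mem_span_singleton_self _)
  obtain ⟨h12, h10, h64⟩ := hs.of_two_large hx hij
    (h.twelve_le hi0 fun e => hi0 (h8 i e)) (h.twelve_le hj0 fun e => hj0 (h8 j e))
    (h.four_dvd_of_aeval_ne_zero hi0)
  apply hi
  refine h.aeval_rel_mem_of_relDeg_eq h10 (fun l hl => ?_) (fun l hl => ?_) h12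
  -- For `u` of degree 6, `D u` is a combination of relations of degree 4, and there are none beside
  -- degree 6 in this budget.
  · have h1 := h.mem_span_rel (h.map_rel_homogeneous (n := 4) hl) (h.map_mem _ (P.rel_mem l))
    have h2 : (Finset.univ.filter fun i => P.relDeg i = 4) = ∅ := by
      rw [Finset.filter_eq_empty_iff]
      exact fun l' _ => h64 l l' hl
    rw [h2, Finset.coe_empty, Set.image_empty, Submodule.span_empty, Submodule.mem_bot] at h1
    rw [h1]
    exact Ideal.zero_mem _
  · rw [h8 l hl]
    exact Ideal.zero_mem _

/-- In small formal dimension, the relations of degree `8` have at least two non-proportional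
images. -/
theorem exists_two_relDeg_eq_eight (h : IsStep P p) {y z : Fin k}
    (hs : IsSmall P.genDeg P.relDeg y z) {c d : Fin k} (hc : p c ≠ 0)
    (hcd : ∀ a : ℚ, p d ≠ a • p c) :
    ∃ i j, P.relDeg i = 8 ∧ P.relDeg j = 8 ∧ aeval p (P.rel i) ≠ 0 ∧
      ∀ a : ℚ, aeval p (P.rel j) ≠ a • aeval p (P.rel i) := by
  obtain ⟨i, hi8, hi0⟩ := h.exists_relDeg_eq_eight hs hc hcd
  by_contra! hall
  have h8 : ∀ l, P.relDeg l = 8 → aeval p (P.rel l) ∈ Ideal.span {aeval p (P.rel i)} := by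
    intro l hl
    obtain ⟨a, ha⟩ := hall i l hi8 hl hi0
    rw [ha, smul_eq_C_mul]
    exact Ideal.mul_mem_left _ _ (Ideal.mem_span_singleton_self _)
  obtain ⟨j, hj⟩ := h.exists_aeval_rel_notMem hc hcd (h.aeval_rel_not_isUnit i)
  have hj0 : aeval p (P.rel j) ≠ 0 := fun e => hj (by rw [e]; exact Ideal.zero_mem _)
  have hmem := h.aeval_rel_mem_span_of_map hi8
  -- A non-zero `φ(uᵢ)` in degree 8 is a combination of `D u` with `u` of degree 6, and each such `D
  -- u` is a combination of relations of degree 4. So both degrees occur.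
  obtain ⟨l₃, h₃, hl₃⟩ : ∃ l, P.relDeg l = 6 ∧ mkDerivation ℚ p (P.rel l) ≠ 0 := by
    by_contra! hz
    apply hi0
    rw [← Submodule.mem_bot ℚ, ← Submodule.span_zero_singleton ℚ]
    refine Submodule.span_mono ?_ hmem
    rintro _ ⟨l, hl, rfl⟩
    exact hz l (by simpa using hl)
  obtain ⟨l₂, h₂⟩ : ∃ l, P.relDeg l = 4 := by
    by_contra! hz
    have h1 := h.mem_span_rel (h.map_rel_homogeneous (n := 4) h₃) (h.map_mem _ (P.rel_mem l₃))
    have h2 : (Finset.univ.filter fun i => P.relDeg i = 4) = ∅ := by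
      rw [Finset.filter_eq_empty_iff]
      exact fun l' _ => hz l'
    rw [h2, Finset.coe_empty, Set.image_empty, Submodule.span_empty, Submodule.mem_bot] at h1
    exact hl₃ h1
  obtain ⟨h12, h10, h6⟩ := hs.of_one_large h₂ h₃ hi8
    (h.twelve_le hj0 fun e => hj (h8 j e)) (h.four_dvd_of_aeval_ne_zero hj0)
  apply hj
  refine h.aeval_rel_mem_of_relDeg_eq h10 (fun l hl => ?_) h8 h12
  obtain rfl := h6 l hl
  -- As `l` is the only relation of degree 6, `D (P.rel l)` is a multiple of `φ(uᵢ)`. The relation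
  -- of degree 12 then maps into the ideal of `φ(uᵢ)`, contrary to the choice of `j`.
  have hle : Submodule.span ℚ ((fun i => mkDerivation ℚ p (P.rel i)) ''
      (Finset.univ.filter fun i => P.relDeg i = 6 : Finset (Fin k)))
      ≤ Submodule.span ℚ {mkDerivation ℚ p (P.rel l)} := by
    apply Submodule.span_mono
    rintro _ ⟨l', hl', rfl⟩
    rw [h6 l' (by simpa using hl')]
    rfl
  obtain ⟨a, ha⟩ := Submodule.mem_span_singleton.1 (hle hmem)
  have ha0 : a ≠ 0 := by
    rintro rfl
    rw [zero_smul] at ha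
    exact hi0 ha.symm
  have hD : mkDerivation ℚ p (P.rel l) = a⁻¹ • aeval p (P.rel i) := by
    rw [← ha, smul_smul, inv_mul_cancel₀ ha0, one_smul]
  rw [hD, smul_eq_C_mul]
  exact Ideal.mul_mem_left _ _ (Ideal.mem_span_singleton_self _)

/-- In small formal dimension the products of the values `p c`, `p d` span a line in the
quotient. -/
theorem exists_rank_one (h : IsStep P p) {y z : Fin k} (hs : IsSmall P.genDeg P.relDeg y z)
    {c d : Fin k} (hc : p c ≠ 0) (hcd : ∀ a : ℚ, p d ≠ a • p c) :
    ∃ ω : P.Alg, ω ≠ 0 ∧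
      (∀ i j, ∃ a : ℚ, Ideal.Quotient.mk P.relIdeal (p i * p j) = a • ω) ∧
      ∃ i j, Ideal.Quotient.mk P.relIdeal (p i * p j) ≠ 0 := by
  obtain ⟨i, j, hi8, hj8, hi0, hij⟩ := h.exists_two_relDeg_eq_eight hs hc hcd
  set A := Finset.univ.filter fun l => P.relDeg l = 4 with hA
  have hcardA : 2 ≤ A.card := two_le_card_of_mem_span A P.rel
    (h.mem_span_rel (h.aeval_rel_homogeneous hi8) (h.aeval_rel_mem hi8))
    (h.mem_span_rel (h.aeval_rel_homogeneous hj8) (h.aeval_rel_mem hj8)) hi0 hij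
  have hcardB : 2 ≤ (Finset.univ.filter fun l => P.relDeg l = 6).card :=
    two_le_card_of_mem_span _ _
      (h.aeval_rel_mem_span_of_map hi8) (h.aeval_rel_mem_span_of_map hj8) hi0 hij
  obtain ⟨hA2, hY2⟩ := hs.card_of_two_le hcardA hcardB
  have hd : p d ≠ 0 := by simpa using hcd 0
  have hcd' : c ≠ d := by
    rintro rfl
    exact hcd 1 (one_smul _ _).symm
  have hgen : ∀ l, p l ≠ 0 → P.genDeg l = 4 := fun l hl =>
    (h.weight_eq l).resolve_left fun e => hl (h.eq_zero l e)
  have hY : ∀ l, P.genDeg l = 4 → l = c ∨ l = d := by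
    have hsub : ({c, d} : Finset (Fin k)) ⊆ Finset.univ.filter fun l => P.genDeg l = 4 := by
      intro l hl
      rw [Finset.mem_insert, Finset.mem_singleton] at hl
      rcases hl with rfl | rfl
      · simp [hgen _ hc]
      · simp [hgen _ hd]
    have heq := Finset.eq_of_subset_of_card_le hsub (by rw [hY2, Finset.card_pair hcd'])
    intro l hl
    have : l ∈ ({c, d} : Finset (Fin k)) := by rw [heq]; simp [hl]
    simpa using this
  set v : Fin 3 → MvPolynomial (Fin k) ℚ := ![p c ^ 2, p c * p d, p d ^ 2] with hv
  have hli : LinearIndependent ℚ v := by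
    rw [Fintype.linearIndependent_iff]
    intro g hg
    rw [Fin.sum_univ_three] at hg
    obtain ⟨h1, h2, h3⟩ := eq_zero_of_quadratic_relation h.two_le (h.homogeneous c)
      (h.homogeneous d) hc hcd hg
    intro l
    fin_cases l
    · exact h1
    · exact h2
    · exact h3
  -- `V` has dimension 3. Its intersection with `I` is at most 2-dimensional, as only two relations
  -- have degree 4, and contains the independent `φ(uᵢ)`, `φ(uⱼ)`. So the image of `V` in `H` is a
  -- line.
  set V := Submodule.span ℚ (Set.range v) with hV
  have hV3 : Module.finrank ℚ V = 3 := by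
    rw [hV, finrank_span_eq_card hli, Fintype.card_fin]
  have hVfin : FiniteDimensional ℚ V := FiniteDimensional.span_of_finite ℚ (Set.finite_range v)
  have hprod : ∀ l l', p l * p l' ∈ V := by
    have hcc : p c * p c ∈ V := Submodule.subset_span ⟨0, by simp [hv, sq]⟩
    have hcd : p c * p d ∈ V := Submodule.subset_span ⟨1, by simp [hv]⟩
    have hdd : p d * p d ∈ V := Submodule.subset_span ⟨2, by simp [hv, sq]⟩
    intro l l'
    rcases h.weight_eq l with e | e
    · rw [h.eq_zero l e, zero_mul]
      exact V.zero_mem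
    rcases h.weight_eq l' with e' | e'
    · rw [h.eq_zero l' e', mul_zero]
      exact V.zero_mem
    rcases hY l e with rfl | rfl <;> rcases hY l' e' with rfl | rfl
    · exact hcc
    · exact hcd
    · rw [mul_comm]
      exact hcd
    · exact hdd
  have hVhom : ∀ f ∈ V, IsWeightedHomogeneous P.genDeg f 4 := by
    have hle : V ≤ weightedHomogeneousSubmodule ℚ P.genDeg 4 := by
      rw [hV, Submodule.span_le]
      rintro _ ⟨l, rfl⟩
      fin_cases l
      · exact (h.homogeneous c).pow 2
      · exact (h.homogeneous c).mul (h.homogeneous d)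
      · exact (h.homogeneous d).pow 2
    exact fun f hf => hle hf
  have haeval : ∀ l, P.relDeg l = 8 → aeval p (P.rel l) ∈ V := by
    intro l hl
    have hhom := P.rel_homogeneous l
    rw [hl] at hhom
    refine Submodule.span_le.2 ?_ (h.aeval_mem_span_mul hhom)
    rintro _ ⟨i', j', -, -, rfl⟩
    exact hprod i' j'
  let π : MvPolynomial (Fin k) ℚ →ₗ[ℚ] P.Alg := (Ideal.Quotient.mkₐ ℚ P.relIdeal).toLinearMap
  have hrank := LinearMap.finrank_range_add_finrank_ker (π.domRestrict V)
  rw [LinearMap.range_domRestrict, hV3, ← Submodule.finrank_map_subtype_eq,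
    LinearMap.ker_domRestrict, Submodule.map_comap_eq, Submodule.range_subtype] at hrank
  have hker : ∀ f, f ∈ LinearMap.ker π ↔ f ∈ P.relIdeal := fun f =>
    Ideal.Quotient.eq_zero_iff_mem
  have hupper : Module.finrank ℚ (V ⊓ LinearMap.ker π : Submodule ℚ _) ≤ 2 := by
    have hle : V ⊓ LinearMap.ker π ≤ Submodule.span ℚ (P.rel '' A) := fun f hf =>
      h.mem_span_rel (hVhom f hf.1) ((hker f).1 hf.2)
    have : FiniteDimensional ℚ (Submodule.span ℚ (P.rel '' A)) :=
      FiniteDimensional.span_of_finite ℚ (A.finite_toSet.image _)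
    refine (Submodule.finrank_mono hle).trans ?_
    classical
    rw [← Finset.coe_image]
    exact ((finrank_span_finset_le_card _).trans Finset.card_image_le).trans hA2.le
  have hlower : 2 ≤ Module.finrank ℚ (V ⊓ LinearMap.ker π : Submodule ℚ _) := by
    have hli2 : LinearIndependent ℚ ![aeval p (P.rel i), aeval p (P.rel j)] :=
      (LinearIndependent.pair_iff' hi0).2 fun a => (hij a).symm
    have h2 := finrank_span_eq_card hli2
    rw [Fintype.card_fin] at h2
    refine h2.symm.le.trans ?_
    have : FiniteDimensional ℚ (V ⊓ LinearMap.ker π : Submodule ℚ _) :=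
      Submodule.finiteDimensional_inf_left V _
    apply Submodule.finrank_mono
    rw [Submodule.span_le]
    rintro _ ⟨l, rfl⟩
    fin_cases l
    · exact ⟨haeval i hi8, (hker _).2 (h.aeval_rel_mem hi8)⟩
    · exact ⟨haeval j hj8, (hker _).2 (h.aeval_rel_mem hj8)⟩
  have hone : Module.finrank ℚ (V.map π) = 1 := by omega
  obtain ⟨⟨ω, hωV⟩, hω0, hω⟩ := finrank_eq_one_iff'.1 hone
  have hω0' : ω ≠ 0 := fun e => hω0 (Subtype.ext e)
  refine ⟨ω, hω0', fun l l' => ?_, ?_⟩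
  · obtain ⟨a, ha⟩ := hω ⟨π (p l * p l'), Submodule.mem_map_of_mem (hprod l l')⟩
    exact ⟨a, (congrArg Subtype.val ha).symm⟩
  · by_contra! hall
    have hbot : V.map π = ⊥ := by
      rw [hV, Submodule.map_span, Submodule.span_eq_bot]
      rintro _ ⟨_, ⟨l, rfl⟩, rfl⟩
      fin_cases l
      · exact (congrArg π (sq (p c))).trans (hall c c)
      · exact hall c d
      · exact (congrArg π (sq (p d))).trans (hall d d)
    rw [hbot, finrank_bot] at hone
    omega

end IsStep

/-- A negative degree derivation of `H` whose values on the generators come from a linear step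
vanishes in small formal dimension. -/
theorem HasDegree.eq_zero_of_isStep {δ : Derivation ℚ P.Alg P.Alg} {e : ℤ}
    (hδ : P.HasDegree δ e) (he : e < 0) (h : IsStep P p)
    (hlift : ∀ i, Ideal.Quotient.mk P.relIdeal (p i) = δ (Ideal.Quotient.mk P.relIdeal (X i)))
    {y z : Fin k} (hs : IsSmall P.genDeg P.relDeg y z) : δ = 0 := by
  by_contra hne
  obtain ⟨c, hc⟩ : ∃ c, δ (Ideal.Quotient.mk P.relIdeal (X c)) ≠ 0 := by
    by_contra! hall
    exact hne (derivation_eq_zero hall)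
  have hpc : p c ≠ 0 := by
    intro e
    apply hc
    rw [← hlift, e, map_zero]
  by_cases hall : ∀ d, ∃ a : ℚ, p d = a • p c
  · choose a ha using hall
    have h0 := hδ.coeff_eq_zero_of_rank_one he (κ := 1) δ.map_one_eq_zero hc (c := a) (fun i => by
      rw [one_mul, ← hlift, ← hlift, ha i]
      exact map_smul (Ideal.Quotient.mkₐ ℚ P.relIdeal) (a i) (p c)) c
    apply hpc
    rw [ha c, h0, zero_smul]
  · push Not at hall
    obtain ⟨d, hcd⟩ := hall
    obtain ⟨ω, hω, hspan, i, j, hij⟩ := h.exists_rank_one hs hpc hcd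
    choose a ha using hspan i
    have hκ : δ (Ideal.Quotient.mk P.relIdeal (p i)) = 0 := by
      rw [← mk_mkDerivation hlift, h.mkDerivation_value, map_zero]
    -- Here `κ = p i`: it is constant for `δ`, and every `κ * δ xₗ = p i * p l` lies on the line of
    -- `ω`.
    have h0 := hδ.coeff_eq_zero_of_rank_one he hκ hω (c := a) (fun l => by
      rw [← hlift, ← map_mul, ha l]) j
    apply hij
    rw [ha j, h0, zero_smul]

theorem HasDegree.apply_X_eq_zero_of_le {δ : Derivation ℚ P.Alg P.Alg} {e : ℤ}
    (hδ : P.HasDegree δ e) {i : Fin k} (hi : (P.genDeg i : ℤ) + e ≤ 0) :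
    δ (Ideal.Quotient.mk P.relIdeal (X i)) = 0 := by
  obtain ⟨p, hp, hlift⟩ := hδ.exists_lift
  rcases hi.lt_or_eq with hlt | heq
  · rw [← hlift, (hp i).2 hlt, map_zero]
  · have h0 := IsStep.exists_eq_C P.genDeg_ne_zero ((hp i).1 0 (by rw [heq]; rfl))
    have h1 : δ (Ideal.Quotient.mk P.relIdeal (X i)) = algebraMap ℚ P.Alg (coeff 0 (p i)) := by
      rw [← hlift]
      exact congrArg (Ideal.Quotient.mk P.relIdeal) h0
    rw [h1, eq_zero_of_apply_eq_algebraMap h1, map_zero]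

end EllipticPresentation

/-! ### Reduction by the degrees of the generators and of the derivation -/

open EllipticPresentation in
/-- The non-splitting hypothesis is not needed: in this range of degrees a non-zero derivation of
negative degree forces `fd H > 20` for split algebras as well. -/
theorem corollary3p4 (k : ℕ) (hk : 2 ≤ k) (P : EllipticPresentation k) (hpure : P.IsPureModel)
    (hsplit : ¬ P.Splits)
    (hdeg : P.genDeg ⟨k - 2, by omega⟩ + P.genDeg ⟨k - 1, by omega⟩ ≤ 8)
    (δ : Derivation ℚ P.Alg P.Alg) (d : ℤ) (hd : d < 0) (hδd : P.HasDegree δ d) (hδ : δ ≠ 0) :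
    20 < P.formalDim := by
  by_contra hfd
  apply hδ
  set y : Fin k := ⟨k - 2, by omega⟩ with hy
  set z : Fin k := ⟨k - 1, by omega⟩ with hz
  have hyz : y ≠ z := by
    rw [Ne, Fin.ext_iff]
    simp only [hy, hz]
    omega
  have hle_z : ∀ i : Fin k, i ≤ z := fun i => by
    rw [Fin.le_def]; simp only [hz]; omega
  have hle_y : ∀ i : Fin k, i ≠ z → i ≤ y := fun i hi => by
    rw [Ne, Fin.ext_iff] at hi
    rw [Fin.le_def]
    simp only [hz, hy] at hi ⊢
    omega
  have hgz : P.genDeg y ≤ P.genDeg z := hpure.genDeg_mono (hle_z y)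
  have h2 : ∀ i, P.genDeg i ≠ 0 ∧ P.genDeg i % 2 = 0 := fun i =>
    ⟨P.genDeg_ne_zero i, Nat.even_iff.1 (P.genDeg_even i)⟩
  have h2y := h2 y
  have h2z := h2 z
  rcases (by omega : P.genDeg y = 2 ∨ (P.genDeg y = 4 ∧ P.genDeg z = 4)) with hy2 | ⟨hy4, hz4⟩
  -- All generators but the last have degree 2. Their images land in degree at most 0, or in the odd
  -- degree 1 when `d = -1`, and vanish.
  · have hzero : ∀ i, i ≠ z → δ (Ideal.Quotient.mk P.relIdeal (X i)) = 0 := by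
      intro i hi
      have hiy := hpure.genDeg_mono (hle_y i hi)
      obtain ⟨p, hp, hlift⟩ := hδd.exists_lift
      by_cases hle : (P.genDeg i : ℤ) + d ≤ 0
      · exact hδd.apply_X_eq_zero_of_le hle
      · obtain ⟨m, hm⟩ := Int.eq_ofNat_of_zero_le (not_le.1 hle).le
        have := h2 i
        rw [← hlift, P.eq_zero_of_odd ((hp i).1 m hm.symm) (Nat.odd_iff.2 (by omega)), map_zero]
    by_contra hne
    have hzne : δ (Ideal.Quotient.mk P.relIdeal (X z)) ≠ 0 := by
      intro h0
      apply hne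
      apply derivation_eq_zero
      intro i
      by_cases hi : i = z
      · rw [hi, h0]
      · exact hzero i hi
    have h1 := hδd.coeff_eq_zero_of_rank_one hd (κ := 1) δ.map_one_eq_zero hzne
      (c := fun i => if i = z then 1 else 0) (fun i => by
        by_cases hi : i = z
        · rw [hi, if_pos rfl, one_mul, one_smul]
        · rw [if_neg hi, hzero i hi, mul_zero, zero_smul]) z
    simp at h1
  · have hgen : ∀ i, P.genDeg i = 2 ∨ P.genDeg i = 4 := by
      intro i
      have := hpure.genDeg_mono (hle_z i)
      have := h2 i
      omega
    have hsmall : IsSmall P.genDeg P.relDeg y z :=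
      { gen := hgen
        two_mul_le := hpure.two_mul_genDeg_le
        ne := hyz
        gen_left := hy4
        gen_right := hz4
        le_right := fun i => hpure.relDeg_mono (hle_z i)
        le_left := fun i hi => hpure.relDeg_mono (hle_y i hi)
        sum_le := P.sum_relDeg_le 20 (by omega)
          (Finset.sum_le_sum fun i _ => by have := hpure.two_mul_genDeg_le i; omega) }
    by_cases hd2 : d = -2
    · subst hd2
      obtain ⟨p', hp', hlift'⟩ := hδd.exists_lift
      -- Resetting the lift to 0 on generators of degree 2 is harmless, as `δ` vanishes on them.
      let p : Fin k → MvPolynomial (Fin k) ℚ := fun i => if P.genDeg i = 2 then 0 else p' i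
      have hlift : ∀ i, Ideal.Quotient.mk P.relIdeal (p i)
          = δ (Ideal.Quotient.mk P.relIdeal (X i)) := by
        intro i
        by_cases hi : P.genDeg i = 2
        · simp only [p, if_pos hi]
          rw [map_zero, hδd.apply_X_eq_zero_of_le (by omega)]
        · simp only [p, if_neg hi]
          exact hlift' i
      have hstep : IsStep P p :=
        { weight_eq := hgen
          eq_zero := fun i hi => if_pos hi
          homogeneous := fun i => by
            by_cases hi : P.genDeg i = 2
            · simp only [p, if_pos hi]
              exact isWeightedHomogeneous_zero _ _ _
            · simp only [p, if_neg hi]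
              have := (hgen i).resolve_left hi
              exact (hp' i).1 2 (by omega)
          map_mem := fun f hf => mkDerivation_mem_relIdeal hlift hf
          four_le := fun j => by
            have := hpure.two_mul_genDeg_le j
            have := hgen j
            omega }
      exact hδd.eq_zero_of_isStep hd hstep hlift hsmall
    -- For `d ≠ -2` a generator of degree 2 or 4 lands in degree at most 0 or in an odd degree.
    · apply derivation_eq_zero
      intro i
      by_cases hle : (P.genDeg i : ℤ) + d ≤ 0
      · exact hδd.apply_X_eq_zero_of_le hle
      · obtain ⟨p, hp, hlift⟩ := hδd.exists_lift
        obtain ⟨m, hm⟩ := Int.eq_ofNat_of_zero_le (not_le.1 hle).le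
        have := hgen i
        rw [← hlift, P.eq_zero_of_odd ((hp i).1 m hm.symm) (Nat.odd_iff.2 (by omega)), map_zero]
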